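/- Let $k\ge 1$ be an integer. Let $\mathbb{H}$ be the upper half-plane, $q=e^{2\pi i z}$, and $\mathcal{D}=\frac{1}{2\pi i}\frac{\partial}{\partial z}$. Let $M^!_{2-2k}$ be the space of weakly holomorphic modular forms of weight $2-2k$ for $\mathrm{SL}_2(\mathbb{Z})$, that is, holomorphic $G:\mathbb{H}\to\mathbb{C}$ with $G\left(\frac{\alpha z+\beta}{\gamma z+\delta}\right)=(\gamma z+\delta)^{2-2k}G(z)$ for all $\left(\begin{smallmatrix}\alpha&\beta\\ \gamma&\delta\end{smallmatrix}\right)\in\mathrm{SL}_2(\mathbb{Z})$ that are meromorphic at the cusp $i\infty$. Let $Q(X,Y)=aX^2+bXY+cY^2$ be an integral binary quadratic form of discriminant $D=b^2-4ac>0$, and let $S_Q=\{z\in\mathbb{H}: a|z|^2+b\,\mathrm{Re}(z)+c=0\}$, directed counterclockwise if $a>0$, clockwise if $a<0$, and upwards if $a=0$. For a function $F$ on $\mathbb{H}$ of weight $2k$, the cycle integral is $$\mathcal{C}(F;Q)=R.\int_{C_Q}F(z)\,Q(z,1)^{k-1}\,dz,$$ defined as follows. * If $D$ is not a square, let $(t,u)$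 be the smallest positive integer solution of $t^2-Du^2=4$ and $g_Q=\left(\begin{smallmatrix}\frac{t+bu}{2}&cu\\ -au&\frac{t-bu}{2}\end{smallmatrix}\right)$. Then $C_Q$ is the directed arc of $S_Q$ from $z$ to $g_Qz$, for any $z\in S_Q$, and the integral is an ordinary one. * If $D$ is a square, then $C_Q=S_Q$, directed from one endpoint $\mathfrak{a}\in\mathbb{Q}\cup\{i\infty\}$ to the other endpoint $\mathfrak{b}$, and with $f(z)=F(z)Q(z,1)^{k-1}$ the integral is the regularized integral $$R.\int_{\mathfrak{a}}^{\mathfrak{b}}f(w)\,dw=R.\int_{z_0}^{\mathfrak{b}}f(w)\,dw-R.\int_{z_0}^{\mathfrak{a}}f(w)\,dw$$ for any $z_0\in\mathbb{H}$. Here $R.\int_{z_0}^{\sigma(i\infty)}f(w)\,dw:=R.\int_{\sigma^{-1}z_0}^{i\infty}(f|_2\sigma)(w)\,dw$ for $\sigma\in\mathrm{SL}_2(\mathbb{Z})$, and $R.\int_{z_0}^{i\infty}f(w)\,dw$ is the value at $u=0$ of the analytic continuation of $u\mapsto\int_{z_0}^{i\infty}e^{iuw}f(w)\,dw$ from a half-plane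 $\mathrm{Re}(u)\gg0$, in which this integral converges. If $G\in M^!_{2-2k}$, then for every integral binary quadratic form $Q$ of positive discriminant (square or not) the cycle integral $\mathcal{C}(\mathcal{D}^{2k-1}(G);Q)$ is well defined and $$\mathcal{C}\left(\mathcal{D}^{2k-1}(G);Q\right)=0.$$ -/

import Mathlib

open Complex
open scoped UpperHalfPlane MatrixGroups ModularForm Manifold

noncomputable section

namespace CycleIntegral

/-! ### Weakly holomorphic modular forms -/

/-- `G : ℍ → ℂ` is a weakly holomorphic modular form of weight `w` for `SL(2, ℤ)`: it is holomorphic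
on `ℍ`, invariant under the weight `w` slash action, and meromorphic at the (only) cusp, i.e.
`q ^ N * G` is bounded near `i∞` for some `N`, where `q = exp (2 π i z)`. -/
structure IsWeaklyHolomorphic (w : ℤ) (G : ℍ → ℂ) : Prop where
  holo : MDifferentiable 𝓘(ℂ) 𝓘(ℂ) G
  slash_eq : ∀ γ : SL(2, ℤ), G ∣[w] γ = G
  meromorphic_at_cusp : ∃ N : ℕ, UpperHalfPlane.IsBoundedAtImInfty
    (fun z : ℍ => exp (2 * Real.pi * I * z) ^ N * G z)

/-! ### Integral binary quadratic forms and their automorphs -/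

/-- The integral binary quadratic form `a X ^ 2 + b X Y + c Y ^ 2`. -/
@[ext]
structure BinaryForm where
  a : ℤ
  b : ℤ
  c : ℤ

namespace BinaryForm

variable (Q : BinaryForm)

/-- The discriminant. -/
def disc : ℤ := Q.b ^ 2 - 4 * Q.a * Q.c

/-- The value `Q(z, 1)`. -/
def eval (z : ℂ) : ℂ := Q.a * z ^ 2 + Q.b * z + Q.c

end BinaryForm

/-- `(t, u)` is the smallest positive solution of `t ^ 2 - D u ^ 2 = 4`. -/
def IsSmallestPell (D t u : ℤ) : Prop :=
  0 < t ∧ 0 < u ∧ t ^ 2 - D * u ^ 2 = 4 ∧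
    ∀ t' u' : ℤ, 0 < t' → 0 < u' → t' ^ 2 - D * u' ^ 2 = 4 → t ≤ t' ∧ u ≤ u'

theorem exists_isSmallestPell (D : ℤ) (h0 : 0 < D) (hD : ¬ IsSquare D) :
    ∃ p : ℤ × ℤ, IsSmallestPell D p.1 p.2 := by
  classical
  have hex : ∃ n : ℕ, 0 < n ∧ ∃ t : ℤ, 0 < t ∧ t ^ 2 - D * (n : ℤ) ^ 2 = 4 := by
    obtain ⟨x, y, hxy, hy⟩ := Pell.exists_of_not_isSquare h0 hD
    refine ⟨2 * y.natAbs, by have := Int.natAbs_pos.mpr hy; omega, 2 * |x|, ?_, ?_⟩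
    · have hx : x ≠ 0 := by
        rintro rfl
        nlinarith [sq_nonneg y]
      have := abs_pos.mpr hx
      omega
    · push_cast
      rw [mul_pow, mul_pow, sq_abs, sq_abs]
      linarith
  obtain ⟨hpos, t, ht, hsol⟩ := Nat.find_spec hex
  refine ⟨(t, (Nat.find hex : ℤ)), ht, Int.natCast_pos.mpr hpos, hsol, ?_⟩
  intro t' u' ht' hu' h'
  have hu : (Nat.find hex : ℤ) ≤ u' := by
    have : Nat.find hex ≤ u'.toNat := by
      refine Nat.find_min' hex ⟨by omega, t', ht', ?_⟩
      rwa [Int.toNat_of_nonneg hu'.le]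
    omega
  refine ⟨?_, hu⟩
  have h1 : (Nat.find hex : ℤ) ^ 2 ≤ u' ^ 2 := pow_le_pow_left₀ (by positivity) hu 2
  have h2 : t ^ 2 ≤ t' ^ 2 := by nlinarith
  exact (pow_le_pow_iff_left₀ ht.le ht'.le two_ne_zero).mp h2

theorem det_automorph (Q : BinaryForm) {t u : ℤ} (h : t ^ 2 - Q.disc * u ^ 2 = 4) :
    (!![(t + Q.b * u) / 2, Q.c * u; -(Q.a * u), (t - Q.b * u) / 2] :
      Matrix (Fin 2) (Fin 2) ℤ).det = 1 := by
  have hpar : Even (t + Q.b * u) := by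
    have h1 : (t + Q.b * u) * (t - Q.b * u) = 2 * (2 - 2 * Q.a * Q.c * u ^ 2) := by
      simp only [BinaryForm.disc] at h
      linear_combination h
    have h2 : Even ((t + Q.b * u) * (t - Q.b * u)) := by
      rw [h1]; exact even_two_mul _
    rcases Int.even_mul.mp h2 with h3 | h3
    · exact h3
    · have : t + Q.b * u = (t - Q.b * u) + 2 * (Q.b * u) := by ring
      rw [this]
      exact h3.add (even_two_mul _)
  obtain ⟨m, hm⟩ := hpar
  have e1 : (t + Q.b * u) / 2 = m := by omega
  have e2 : (t - Q.b * u) / 2 = m - Q.b * u := by omega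
  rw [Matrix.det_fin_two_of, e1, e2]
  have ht : t = 2 * m - Q.b * u := by omega
  subst ht
  simp only [BinaryForm.disc] at h
  nlinarith

open Classical in
/-- The automorph `g_Q = ((t + b u) / 2, c u; -a u, (t - b u) / 2)` with `(t, u)` the smallest
positive solution of `t ^ 2 - D u ^ 2 = 4`, for a form of positive non-square discriminant `D`
(and the identity otherwise). -/
def automorph (Q : BinaryForm) : SL(2, ℤ) :=
  if h : 0 < Q.disc ∧ ¬ IsSquare Q.disc then
    ⟨_, det_automorph Q (exists_isSmallestPell Q.disc h.1 h.2).choose_spec.2.2.1⟩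
  else 1

/-! ### The geodesic of a form of positive discriminant -/

/-- The geodesic `S_Q`, given by `a |z| ^ 2 + b Re z + c = 0`. -/
def geodesic (Q : BinaryForm) : Set ℍ :=
  {z | Q.a * normSq (z : ℂ) + Q.b * z.re + Q.c = 0}

/-- For `a ≠ 0`: the (real) centre of the semicircle `S_Q`. -/
def center (Q : BinaryForm) : ℝ := -Q.b / (2 * Q.a)

/-- For `a ≠ 0`: the radius of the semicircle `S_Q`. -/
def radius (Q : BinaryForm) : ℝ := √(Q.disc : ℝ) / (2 * |(Q.a : ℝ)|)

/-- For `a ≠ 0`: the pullback of `f(z) dz` to the semicircle `S_Q` along the parametrization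
`θ ↦ center + radius * exp (i θ)`. -/
def arcIntegrand (f : ℍ → ℂ) (Q : BinaryForm) (θ : ℝ) : ℂ :=
  f (UpperHalfPlane.ofComplex (circleMap (center Q) (radius Q) θ)) *
    deriv (circleMap (center Q) (radius Q)) θ

/-- For `a ≠ 0`: the angle of `z ∈ S_Q` in that parametrization, in `(0, π)`. -/
def angle (Q : BinaryForm) (z : ℍ) : ℝ := arg ((z : ℂ) - center Q)

/-- The integral of `f(z) dz` along the directed arc of `S_Q` from `z` to `w` exists and has the
value `v` (for `a ≠ 0`, `z, w ∈ S_Q`). -/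
def HasArcIntegral (f : ℍ → ℂ) (Q : BinaryForm) (z w : ℍ) (v : ℂ) : Prop :=
  IntervalIntegrable (arcIntegrand f Q) MeasureTheory.volume (angle Q z) (angle Q w) ∧
    ∫ θ in (angle Q z)..(angle Q w), arcIntegrand f Q θ = v

/-! ### Regularized integrals -/

/-- The pullback of `exp (i u w) f(w) dw` to the vertical ray `t ↦ z₀ + i t` from `z₀` to `i∞`. -/
def rayIntegrand (f : ℍ → ℂ) (z₀ : ℍ) (u : ℂ) (t : ℝ) : ℂ :=
  exp (u * I * ((z₀ : ℂ) + t * I)) * f (UpperHalfPlane.ofComplex ((z₀ : ℂ) + t * I)) * I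

/-- `R.∫_{z₀}^{i∞} f(w) dw` exists and has the value `v`: the integral of `exp (i u w) f(w) dw` from
`z₀` to `i∞` converges for `Re u` large, and, as a function of `u`, it has an analytic continuation
to `u = 0` (to a connected open set containing both `0` and a right half plane) with the
value `v` there. -/
def HasRegIntegral (f : ℍ → ℂ) (z₀ : ℍ) (v : ℂ) : Prop :=
  ∃ (r : ℝ) (U : Set ℂ) (Φ : ℂ → ℂ),
    IsOpen U ∧ IsPreconnected U ∧ {u : ℂ | r < u.re} ⊆ U ∧ (0 : ℂ) ∈ U ∧
    AnalyticOnNhd ℂ Φ U ∧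
    (∀ u : ℂ, r < u.re →
      MeasureTheory.IntegrableOn (rayIntegrand f z₀ u) (Set.Ioi 0) ∧
        Φ u = ∫ t in Set.Ioi (0 : ℝ), rayIntegrand f z₀ u t) ∧
    Φ 0 = v

/-- `σ` is a scaling matrix of the cusp `𝔞`, i.e. `σ ∞ = 𝔞`. -/
def IsScaling (σ : SL(2, ℤ)) (𝔞 : OnePoint ℚ) : Prop :=
  Matrix.SpecialLinearGroup.mapGL ℚ σ • (OnePoint.infty : OnePoint ℚ) = 𝔞

/-- `R.∫_𝔞^𝔟 f(w) dw` exists and has the value `v`: for every base point `z₀` and all scaling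
matrices of the two cusps, `v = R.∫_{z₀}^𝔟 f(w) dw - R.∫_{z₀}^𝔞 f(w) dw`, where
`R.∫_{z₀}^{σ ∞} f(w) dw = R.∫_{σ⁻¹ z₀}^{i∞} (f|₂σ)(w) dw`. -/
def HasRegCuspIntegral (f : ℍ → ℂ) (𝔞 𝔟 : OnePoint ℚ) (v : ℂ) : Prop :=
  ∀ (z₀ : ℍ) (σ τ : SL(2, ℤ)), IsScaling σ 𝔞 → IsScaling τ 𝔟 →
    ∃ v₁ v₂ : ℂ, HasRegIntegral (f ∣[(2 : ℤ)] σ) (σ⁻¹ • z₀) v₁ ∧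
      HasRegIntegral (f ∣[(2 : ℤ)] τ) (τ⁻¹ • z₀) v₂ ∧ v = v₂ - v₁

/-! ### Cycle integrals -/

/-- The initial point of the directed geodesic `S_Q` of a form of positive square discriminant:
counterclockwise if `a > 0`, clockwise if `a < 0`, upwards if `a = 0`. -/
def startCusp (Q : BinaryForm) : OnePoint ℚ :=
  if Q.a = 0 then ((-Q.c / Q.b : ℚ) : OnePoint ℚ)
  else (((-Q.b + Int.sqrt Q.disc) / (2 * Q.a) : ℚ) : OnePoint ℚ)

/-- The end point of the directed geodesic `S_Q` of a form of positive square discriminant. -/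
def endCusp (Q : BinaryForm) : OnePoint ℚ :=
  if Q.a = 0 then OnePoint.infty
  else (((-Q.b - Int.sqrt Q.disc) / (2 * Q.a) : ℚ) : OnePoint ℚ)

/-- The integrand `F(z) Q(z, 1) ^ (k - 1)`. -/
def cycleIntegrand (k : ℤ) (F : ℍ → ℂ) (Q : BinaryForm) (z : ℍ) : ℂ :=
  F z * Q.eval z ^ (k - 1)

/-- For `Q` of positive discriminant: the cycle integral
`C(F; Q) = R.∫_{C_Q} F(z) Q(z, 1) ^ (k - 1) dz` of a function `F` of weight `2 k` is defined and has
the value `v`. If the discriminant is not a square, `C_Q` is the directed arc from `z` to `g_Q z`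
along `S_Q`, for any `z ∈ S_Q`; if it is a square, `C_Q` is the whole of `S_Q`, directed from one
rational end point to the other, and the integral is regularized. -/
def HasCycleIntegral (k : ℤ) (F : ℍ → ℂ) (Q : BinaryForm) (v : ℂ) : Prop :=
  (¬ IsSquare Q.disc → ∀ z ∈ geodesic Q,
    HasArcIntegral (cycleIntegrand k F Q) Q z (automorph Q • z) v) ∧
  (IsSquare Q.disc → HasRegCuspIntegral (cycleIntegrand k F Q) (startCusp Q) (endCusp Q) v)

end CycleIntegral

end

noncomputable section

namespace CycleIntegral

/-! Put n = 2k - 2 and m = k - 1. Up to a power of 2πi the integrand is G⁽ⁿ⁺¹⁾P with P = Q(z,1)^m of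
degree at most n, so repeated integration by parts gives an explicit primitive, `pairing` of G with
P. Since G has weight -n, this primitive is covariant: its value at σz for Q is its value at z for
Q∘σ (`IsWeaklyHolomorphic.pairing_moebius`).

If the discriminant is not a square, g_Q fixes Q, so the primitive agrees at the two ends of the arc
and the integral vanishes.

If it is a square, Bol's identity turns the integral towards the cusp σ∞ into one towards i∞ with
Q∘σ in place of Q. There the q-expansion is integrated termwise. Every nonconstant exponential,
growing or decaying, contributes minus its primitive at the base point. The constant term c₀ has
zero (n+1)-st derivative but enters the primitive, so c₀(-1)ⁿP⁽ⁿ⁾ must be added back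
(`IsWeaklyHolomorphic.exists_hasContinuation`). Here P⁽ⁿ⁾ is a multiple of the m-th power of the
leading coefficient of Q∘σ, which vanishes because σ∞ is a root of Q; for m = 0 it is 1 for every
cusp. By covariance both cusps therefore give the same regularized value, and the difference is 0.

Well-definedness also needs uniqueness of the regularized value for an arbitrary domain of
continuation; this is why continuations to all left-bounded half-planes are constructed. -/

open Polynomial in
/-- The alternating pairing `∑ⱼ (-1)ʲ H⁽ⁿ⁻ʲ⁾ P⁽ʲ⁾` of a sequence of successive derivatives with a
polynomial. -/
def pairing (n : ℕ) (H : ℕ → ℂ → ℂ) (P : ℂ[X]) (z : ℂ) : ℂ :=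
  ∑ j ∈ Finset.range (n + 1), (-1) ^ j * H (n - j) z * (derivative^[j] P).eval z

/-- Each function of the sequence is, on the upper half-plane, the derivative of the previous
one. -/
def IsDerivSeq (H : ℕ → ℂ → ℂ) : Prop :=
  ∀ m z, 0 < z.im → HasDerivAt (H m) (H (m + 1) z) z

/-! ### The primitive obtained by integration by parts -/

section Pairing

open Polynomial

variable {n : ℕ} {H : ℕ → ℂ → ℂ}

/-- The product rule telescopes; the last term contains the (n+1)-st derivative of P, which the
degree bound kills. -/
theorem hasDerivAt_pairing (hH : IsDerivSeq H) {P : ℂ[X]} (hP : P.natDegree ≤ n) {z : ℂ}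
    (hz : 0 < z.im) : HasDerivAt (pairing n H P) (H (n + 1) z * P.eval z) z := by
  have key : H (n + 1) z * P.eval z = ∑ j ∈ Finset.range (n + 1),
      ((-1) ^ j * H (n - j + 1) z * (derivative^[j] P).eval z +
        (-1) ^ j * H (n - j) z * (derivative (derivative^[j] P)).eval z) := by
    let a : ℕ → ℂ := fun j => (-1) ^ j * H (n + 1 - j) z * (derivative^[j] P).eval z
    have h1 : ∑ j ∈ Finset.range (n + 1), (a j - a (j + 1)) = a 0 - a (n + 1) :=
      Finset.sum_range_sub' a (n + 1)
    have h2 : a (n + 1) = 0 := by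
      simp only [a]
      rw [iterate_derivative_eq_zero (by omega)]
      simp
    rw [h2, sub_zero] at h1
    have h3 : a 0 = H (n + 1) z * P.eval z := by simp [a]
    rw [← h3, ← h1]
    refine Finset.sum_congr rfl fun j hj => ?_
    have hj' : j ≤ n := by simpa [Nat.lt_succ_iff] using hj
    simp only [a]
    rw [show n + 1 - j = n - j + 1 by omega, show n + 1 - (j + 1) = n - j by omega,
      Function.iterate_succ_apply', pow_succ]
    ring
  rw [key]
  unfold pairing
  refine HasDerivAt.fun_sum fun j _ => ?_
  exact ((hH (n - j) z hz).const_mul _).mul (Polynomial.hasDerivAt _ z)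

theorem pairing_add_right (P P' : ℂ[X]) (z : ℂ) :
    pairing n H (P + P') z = pairing n H P z + pairing n H P' z := by
  simp only [pairing, ← Finset.sum_add_distrib]
  refine Finset.sum_congr rfl fun j _ => ?_
  rw [iterate_map_add, eval_add]
  ring

theorem pairing_smul_right (c : ℂ) (P : ℂ[X]) (z : ℂ) :
    pairing n H (c • P) z = c * pairing n H P z := by
  simp only [pairing, Finset.mul_sum]
  refine Finset.sum_congr rfl fun j _ => ?_
  rw [iterate_derivative_smul, eval_smul, smul_eq_mul]
  ring

theorem pairing_zero_right (z : ℂ) : pairing n H 0 z = 0 := by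
  simpa using pairing_smul_right (n := n) (H := H) 0 0 z

theorem pairing_sum_right {ι : Type*} (s : Finset ι) (P : ι → ℂ[X]) (z : ℂ) :
    pairing n H (∑ i ∈ s, P i) z = ∑ i ∈ s, pairing n H (P i) z := by
  classical
  induction s using Finset.induction_on with
  | empty => simp [pairing_zero_right]
  | insert i s hi ih => rw [Finset.sum_insert hi, Finset.sum_insert hi, pairing_add_right, ih]

theorem iterate_derivative_linear_pow (α β : ℂ) (n j : ℕ) :
    derivative^[j] ((C α * X + C β) ^ n) =
      C ((n.descFactorial j : ℂ) * α ^ j) * (C α * X + C β) ^ (n - j) := by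
  induction j with
  | zero => simp
  | succ j ih =>
    rw [Function.iterate_succ_apply', ih, derivative_C_mul, derivative_pow]
    simp only [derivative_add, derivative_C_mul, derivative_X, derivative_C, add_zero, mul_one,
      Nat.descFactorial_succ, Nat.cast_mul, map_mul, pow_succ, map_natCast, ← Nat.sub_sub,
      map_pow]
    ring

theorem pairing_linear_pow (α β z : ℂ) :
    pairing n H ((C α * X + C β) ^ n) z = n.factorial *
      ∑ m ∈ Finset.range (n + 1),
        H m z / m.factorial * (-α) ^ (n - m) * (α * z + β) ^ m := by
  rw [pairing, ← Finset.sum_range_reflect, Finset.mul_sum]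
  refine Finset.sum_congr rfl fun m hm => ?_
  have hm' : m ≤ n := by simpa [Nat.lt_succ_iff] using hm
  rw [show n + 1 - 1 - m = n - m by omega, show n - (n - m) = m by omega,
    iterate_derivative_linear_pow, show n - (n - m) = m by omega]
  have hf : (n.factorial : ℂ) = m.factorial * n.descFactorial (n - m) := by
    have := Nat.factorial_mul_descFactorial (n := n) (k := n - m) (by omega)
    rw [show n - (n - m) = m by omega] at this
    exact_mod_cast this.symm
  have h0 : (m.factorial : ℂ) ≠ 0 := by exact_mod_cast m.factorial_ne_zero
  simp only [eval_mul, eval_C, eval_pow, eval_add, eval_X]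
  rw [hf, neg_pow α]
  field_simp

end Pairing

/-! ### Covariance of the primitive and Bol's identity -/

section Covariance

open Polynomial

variable {n : ℕ} {H : ℕ → ℂ → ℂ} {a b c d : ℂ} {g : ℂ → ℂ}

/-- Hypotheses on a Möbius map `g` of the upper half-plane under which `H 0` has weight `-n`. -/
structure IsCovariant (n : ℕ) (H : ℕ → ℂ → ℂ) (a b c d : ℂ) (g : ℂ → ℂ) : Prop where
  derivSeq : IsDerivSeq H
  det : a * d - b * c = 1
  denom_ne : ∀ z : ℂ, 0 < z.im → c * z + d ≠ 0
  im_pos : ∀ z : ℂ, 0 < z.im → 0 < (g z).im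
  map_eq : ∀ z : ℂ, 0 < z.im → g z = (a * z + b) / (c * z + d)
  zero_eq : ∀ z : ℂ, 0 < z.im → H 0 z = (c * z + d) ^ n * H 0 (g z)

theorem isOpen_im_pos : IsOpen {z : ℂ | 0 < z.im} := isOpen_lt continuous_const continuous_im

theorem IsCovariant.hasDerivAt_map (h : IsCovariant n H a b c d g) {z : ℂ} (hz : 0 < z.im) :
    HasDerivAt g (1 / (c * z + d) ^ 2) z := by
  have hj := h.denom_ne z hz
  have h1 : HasDerivAt (fun z => a * z + b) a z := by
    simpa using ((hasDerivAt_id z).const_mul a).add_const b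
  have h2 : HasDerivAt (fun z => c * z + d) c z := by
    simpa using ((hasDerivAt_id z).const_mul c).add_const d
  have h3 := h1.div h2 hj
  have h4 : (a * (c * z + d) - (a * z + b) * c) / (c * z + d) ^ 2 = 1 / (c * z + d) ^ 2 := by
    congr 1
    linear_combination h.det
  rw [h4] at h3
  refine h3.congr_of_eventuallyEq ?_
  filter_upwards [isOpen_im_pos.mem_nhds hz] with w hw
  exact h.map_eq w hw

theorem IsCovariant.hasDerivAt_comp (h : IsCovariant n H a b c d g) {z : ℂ} (hz : 0 < z.im)
    (r : ℕ) : HasDerivAt (fun z => H r (g z)) (H (r + 1) (g z) * (1 / (c * z + d) ^ 2)) z :=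
  (h.derivSeq r (g z) (h.im_pos z hz)).comp z (h.hasDerivAt_map hz)

/-- Pascal's rule and the absorption identity. It matches coefficients in the induction of
`IsCovariant.transform`, with N = n - r and s = m - r. -/
theorem choose_transform_identity (N s r : ℕ) :
    (N.choose s : ℂ) * ((N : ℂ) - s - r) + (N + 1).choose (s + 1) * r =
      (s + 1 + r) * N.choose (s + 1) := by
  have h1 : ((N + 1).choose (s + 1) : ℂ) = N.choose s + N.choose (s + 1) := by
    exact_mod_cast Nat.choose_succ_succ N s
  have h2 : (N.choose (s + 1) : ℂ) * (s + 1) = N.choose s * (N - s) := by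
    rcases le_or_gt s N with hs | hs
    · have := Nat.choose_succ_right_eq N s
      have h3 : ((N - s : ℕ) : ℂ) = N - s := Nat.cast_sub hs
      rw [← h3]
      exact_mod_cast this
    · simp [Nat.choose_eq_zero_of_lt hs, Nat.choose_eq_zero_of_lt (show N < s + 1 by omega)]
  rw [h1]
  linear_combination -h2

/-- Induction on m: differentiate the identity, multiply by cz + d, and subtract the contribution of
the derivative of (cz + d)^m. -/
theorem IsCovariant.transform (h : IsCovariant n H a b c d g) {m : ℕ} (hm : m ≤ n) :
    ∀ z : ℂ, 0 < z.im → (c * z + d) ^ m * (H m z / m.factorial) =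
      ∑ r ∈ Finset.range (m + 1), ((n - r).choose (m - r) : ℂ) * c ^ (m - r) *
        (c * z + d) ^ (n - r) * (H r (g z) / r.factorial) := by
  induction m with
  | zero =>
    intro z hz
    simpa using h.zero_eq z hz
  | succ m ih =>
    intro z hz
    have ih := ih (by omega)
    have hj := h.denom_ne z hz
    have hlin : HasDerivAt (fun z => c * z + d) c z := by
      simpa using ((hasDerivAt_id z).const_mul c).add_const d
    have hL := (hlin.pow m).mul ((h.derivSeq m z hz).div_const (m.factorial : ℂ))
    have hR : HasDerivAt (fun z => ∑ r ∈ Finset.range (m + 1),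
        ((n - r).choose (m - r) : ℂ) * c ^ (m - r) *
        (c * z + d) ^ (n - r) * (H r (g z) / r.factorial)) _ z :=
      HasDerivAt.fun_sum fun r _ =>
        ((hlin.pow (n - r)).const_mul (((n - r).choose (m - r) : ℂ) * c ^ (m - r))).mul
          ((h.hasDerivAt_comp hz r).div_const (r.factorial : ℂ))
    have heq := (hL.congr_of_eventuallyEq (f₁ := fun z => ∑ r ∈ Finset.range (m + 1),
        ((n - r).choose (m - r) : ℂ) * c ^ (m - r) *
        (c * z + d) ^ (n - r) * (H r (g z) / r.factorial)) (by
      filter_upwards [isOpen_im_pos.mem_nhds hz] with w hw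
      exact (ih w hw).symm)).unique hR
    have hmz := ih z hz
    set J := c * z + d with hJ
    let S : ℕ → ℂ := fun r => ((n + 1 - r).choose (m + 1 - r) : ℂ) * c ^ (m + 1 - r) *
      J ^ (n - r) * (r * (H r (g z) / r.factorial))
    have hS : ∑ r ∈ Finset.range (m + 1), S (r + 1) =
        ∑ r ∈ Finset.range (m + 1), S r + S (m + 1) := by
      have h0 : S 0 = 0 := by simp [S]
      rw [← Finset.sum_range_succ, Finset.sum_range_succ' S (m + 1), h0, add_zero]
    have hf0 : (m.factorial : ℂ) ≠ 0 := by exact_mod_cast m.factorial_ne_zero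
    have hm1 : ((m : ℂ) + 1) ≠ 0 := by exact_mod_cast m.succ_ne_zero
    have hmain : J ^ (m + 1) * (H (m + 1) z / m.factorial) =
        ∑ r ∈ Finset.range (m + 1), (((n - r).choose (m - r) : ℂ) * c ^ (m + 1 - r) *
          ((n : ℂ) - r - m) * J ^ (n - r) * (H r (g z) / r.factorial)) +
        ∑ r ∈ Finset.range (m + 1), S (r + 1) := by
      have e1 : J ^ (m + 1) * (H (m + 1) z / m.factorial) =
          J * (m * J ^ (m - 1) * c * (H m z / m.factorial) + J ^ m * (H (m + 1) z / m.factorial))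
            - m * c * (J ^ m * (H m z / m.factorial)) := by
        rcases m with _ | m
        · simp
        · simp only [Nat.add_sub_cancel]
          ring
      rw [e1, hmz]
      simp only [Pi.pow_apply] at heq
      rw [← hJ] at heq
      rw [heq, Finset.mul_sum, Finset.mul_sum, ← Finset.sum_sub_distrib, ← Finset.sum_add_distrib]
      refine Finset.sum_congr rfl fun r hr => ?_
      have hr' : r ≤ m := by simpa [Nat.lt_succ_iff] using hr
      obtain ⟨t, ht⟩ : ∃ t, n = r + t + 1 := ⟨n - r - 1, by omega⟩
      obtain ⟨q, rfl⟩ : ∃ q, m = r + q := ⟨m - r, by omega⟩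
      have hr0 : (r.factorial : ℂ) ≠ 0 := by exact_mod_cast r.factorial_ne_zero
      have hr1 : ((r : ℂ) + 1) ≠ 0 := by exact_mod_cast r.succ_ne_zero
      simp only [S]
      rw [show n - r = t + 1 by omega, show r + q - r = q by omega, show r + q + 1 - r = q + 1 by omega,
        show n + 1 - (r + 1) = t + 1 by omega, show r + q + 1 - (r + 1) = q by omega,
        show n - (r + 1) = t by omega, show t + 1 - 1 = t by omega, ht, Nat.factorial_succ]
      push_cast
      field_simp
      ring
    have hfac : ((m + 1).factorial : ℂ) = (m + 1) * m.factorial := by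
      rw [Nat.factorial_succ]; push_cast; ring
    have e2 : J ^ (m + 1) * (H (m + 1) z / (m + 1).factorial) =
        (J ^ (m + 1) * (H (m + 1) z / m.factorial)) / (m + 1) := by
      rw [hfac]; field_simp
    rw [e2, hmain, hS, div_eq_iff hm1, ← add_assoc, ← Finset.sum_add_distrib,
      Finset.sum_range_succ _ (m + 1), add_mul, Finset.sum_mul]
    congr 1
    · refine Finset.sum_congr rfl fun r hr => ?_
      have hr' : r ≤ m := by simpa [Nat.lt_succ_iff] using hr
      obtain ⟨t, ht⟩ : ∃ t, n = r + t := ⟨n - r, by omega⟩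
      obtain ⟨q, rfl⟩ : ∃ q, m = r + q := ⟨m - r, by omega⟩
      have := choose_transform_identity t q r
      simp only [S]
      rw [show n - r = t by omega, show r + q - r = q by omega, show r + q + 1 - r = q + 1 by omega,
        show n + 1 - r = t + 1 by omega, ht]
      push_cast
      linear_combination (c ^ (q + 1) * J ^ t * (H r (g z) / r.factorial)) * this
    · simp only [S, Nat.sub_self, Nat.choose_zero_right]
      push_cast
      ring

/-- Insert `IsCovariant.transform` into the expansion at z and exchange the sums. The inner sum is
the binomial expansion of (cL - α'J)^(n-r), and cL - α'J = -α by the determinant condition. -/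
theorem IsCovariant.pairing_linear_pow (h : IsCovariant n H a b c d g) (α β : ℂ) {z : ℂ}
    (hz : 0 < z.im) : pairing n H ((C α * X + C β) ^ n) (g z) =
      pairing n H ((C (α * a + β * c) * X + C (α * b + β * d)) ^ n) z := by
  have hj := h.denom_ne z hz
  rw [CycleIntegral.pairing_linear_pow, CycleIntegral.pairing_linear_pow]
  congr 1
  set J := c * z + d with hJ
  set α' := α * a + β * c with hα'
  set L := α' * z + (α * b + β * d) with hL
  have e1 : α * g z + β = L / J := by
    rw [h.map_eq z hz, ← hJ, hL, hα']
    field_simp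
    rw [hJ]
    ring
  have e2 : -α = c * L + -(α' * J) := by
    rw [hJ, hL, hα']
    linear_combination α * h.det
  symm
  have hterm : ∀ m ∈ Finset.range (n + 1), H m z / m.factorial * (-α') ^ (n - m) * L ^ m =
      ∑ r ∈ Finset.range (m + 1), (H r (g z) / r.factorial) * (L / J) ^ r *
        (((n - r).choose (m - r) : ℂ) * (c * L) ^ (m - r) * (-(α' * J)) ^ (n - r - (m - r))) := by
    intro m hm
    have hm' : m ≤ n := by simpa [Nat.lt_succ_iff] using hm
    have ht := h.transform hm' z hz
    rw [← hJ] at ht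
    have : H m z / m.factorial * (-α') ^ (n - m) * L ^ m =
        (J ^ m * (H m z / m.factorial)) * ((-α') ^ (n - m) * L ^ m / J ^ m) := by
      field_simp
    rw [this, ht, Finset.sum_mul]
    refine Finset.sum_congr rfl fun r hr => ?_
    have hr' : r ≤ m := by simpa [Nat.lt_succ_iff] using hr
    obtain ⟨q, rfl⟩ : ∃ q, m = r + q := ⟨m - r, by omega⟩
    obtain ⟨t, ht⟩ : ∃ t, n = r + q + t := ⟨n - (r + q), by omega⟩
    rw [show n - r = q + t by omega, show r + q - r = q by omega, show n - (r + q) = t by omega,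
      show q + t - q = t by omega, neg_mul_eq_neg_mul, mul_pow, mul_pow, div_pow]
    field_simp
    ring
  rw [Finset.sum_congr rfl hterm]
  -- The triangle r ≤ m ≤ n is reindexed by r and s = m - r.
  rw [Finset.sum_sigma', Finset.sum_bij' (t := (Finset.range (n + 1)).sigma
      fun r => Finset.range (n - r + 1))
      (g := fun x => (H x.1 (g z) / x.1.factorial) * (L / J) ^ x.1 *
        (((n - x.1).choose x.2 : ℂ) * (c * L) ^ x.2 * (-(α' * J)) ^ (n - x.1 - x.2)))
      (fun x _ => ⟨x.2, x.1 - x.2⟩) (fun x _ => ⟨x.1 + x.2, x.1⟩)]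
  · rw [Finset.sum_sigma]
    refine Finset.sum_congr rfl fun r hr => ?_
    have hbin : ∑ s ∈ Finset.range (n - r + 1), (((n - r).choose s : ℂ) * (c * L) ^ s *
        (-(α' * J)) ^ (n - r - s)) = (-α) ^ (n - r) := by
      rw [e2, add_pow]
      exact Finset.sum_congr rfl fun s _ => by ring
    dsimp only
    rw [← Finset.mul_sum, hbin, e1, mul_right_comm]
  · simp only [Finset.mem_sigma, Finset.mem_range]
    intro x hx
    omega
  · simp only [Finset.mem_sigma, Finset.mem_range]
    intro x hx
    omega
  · rintro ⟨x, y⟩ hx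
    simp only [Finset.mem_sigma, Finset.mem_range] at hx
    rw [Sigma.mk.injEq]
    exact ⟨by dsimp only; omega, heq_of_eq rfl⟩
  · rintro ⟨x, y⟩ hx
    rw [Sigma.mk.injEq]
    exact ⟨rfl, heq_of_eq (by dsimp only; omega)⟩
  · rintro ⟨x, y⟩ hx
    rfl

/-- Polarization: apply the case of a single linear form to ℓ₁ + sℓ₂ and compare the coefficients of
s^m, where (ℓ₁ℓ₂)^m appears with a nonzero binomial factor. -/
theorem IsCovariant.pairing_mul_pow {m : ℕ} (h : IsCovariant (m + m) H a b c d g)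
    (α₁ β₁ α₂ β₂ : ℂ) {z : ℂ} (hz : 0 < z.im) :
    pairing (m + m) H (((C α₁ * X + C β₁) * (C α₂ * X + C β₂)) ^ m) (g z) =
      pairing (m + m) H (((C (α₁ * a + β₁ * c) * X + C (α₁ * b + β₁ * d)) *
        (C (α₂ * a + β₂ * c) * X + C (α₂ * b + β₂ * d))) ^ m) z := by
  have expand : ∀ (A B A' B' s w : ℂ),
      pairing (m + m) H ((C (A + s * A') * X + C (B + s * B')) ^ (m + m)) w =
      (∑ i ∈ Finset.range (m + m + 1), C (((m + m).choose i : ℂ) * pairing (m + m) H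
        ((C A' * X + C B') ^ i * (C A * X + C B) ^ (m + m - i)) w) * X ^ i).eval s := by
    intro A B A' B' s w
    have : (C (A + s * A') * X + C (B + s * B')) ^ (m + m) =
        ∑ i ∈ Finset.range (m + m + 1), (s ^ i * ((m + m).choose i : ℂ)) •
          ((C A' * X + C B') ^ i * (C A * X + C B) ^ (m + m - i)) := by
      rw [show C (A + s * A') * X + C (B + s * B') =
        C s * (C A' * X + C B') + (C A * X + C B) by simp only [map_add, map_mul]; ring, add_pow]
      refine Finset.sum_congr rfl fun i _ => ?_
      rw [smul_eq_C_mul, mul_pow, map_mul, map_pow, map_natCast]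
      ring
    rw [this, pairing_sum_right, eval_finsetSum]
    refine Finset.sum_congr rfl fun i _ => ?_
    rw [pairing_smul_right]
    simp only [eval_mul, eval_C, eval_pow, eval_X]
    ring
  have hpoly := Polynomial.funext (p := ∑ i ∈ Finset.range (m + m + 1),
      C (((m + m).choose i : ℂ) * pairing (m + m) H
        ((C α₂ * X + C β₂) ^ i * (C α₁ * X + C β₁) ^ (m + m - i)) (g z)) * X ^ i)
    (q := ∑ i ∈ Finset.range (m + m + 1), C (((m + m).choose i : ℂ) * pairing (m + m) H
        ((C (α₂ * a + β₂ * c) * X + C (α₂ * b + β₂ * d)) ^ i *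
          (C (α₁ * a + β₁ * c) * X + C (α₁ * b + β₁ * d)) ^ (m + m - i)) z) * X ^ i) (by
      intro s
      rw [← expand, ← expand, h.pairing_linear_pow _ _ hz]
      rw [show (α₁ + s * α₂) * a + (β₁ + s * β₂) * c =
          (α₁ * a + β₁ * c) + s * (α₂ * a + β₂ * c) by ring,
        show (α₁ + s * α₂) * b + (β₁ + s * β₂) * d =
          (α₁ * b + β₁ * d) + s * (α₂ * b + β₂ * d) by ring])
  have hcoeff := congrArg (fun p => p.coeff m) hpoly
  simp only [finsetSum_coeff, coeff_C_mul_X_pow, Finset.sum_ite_eq, Finset.mem_range] at hcoeff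
  rw [if_pos (by omega), if_pos (by omega), show m + m - m = m by omega] at hcoeff
  have hc : ((m + m).choose m : ℂ) ≠ 0 := by
    exact_mod_cast (Nat.choose_pos (by omega : m ≤ m + m)).ne'
  have := mul_left_cancel₀ hc hcoeff
  rw [mul_pow, mul_pow, mul_comm, this, mul_comm]

theorem natDegree_linear_pow_le (α β : ℂ) (n : ℕ) : ((C α * X + C β) ^ n).natDegree ≤ n := by
  refine natDegree_pow_le.trans ?_
  simpa using Nat.mul_le_mul_left n (natDegree_linear_le (a := α) (b := β))

/-- Bol's identity. -/
theorem IsCovariant.bol (h : IsCovariant n H a b c d g) {z : ℂ} (hz : 0 < z.im) :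
    H (n + 1) (g z) = (c * z + d) ^ (n + 2) * H (n + 1) z := by
  have hj := h.denom_ne z hz
  have hL : ∀ α β : ℂ, HasDerivAt (fun z => pairing n H ((C α * X + C β) ^ n) (g z))
      (H (n + 1) (g z) * (α * g z + β) ^ n * (1 / (c * z + d) ^ 2)) z := by
    intro α β
    have := (hasDerivAt_pairing h.derivSeq (natDegree_linear_pow_le α β n)
      (h.im_pos z hz)).comp z (h.hasDerivAt_map hz)
    simp only [eval_pow, eval_add, eval_mul, eval_C, eval_X] at this
    exact this
  have hR : ∀ α β : ℂ, HasDerivAt (fun z => pairing n H ((C α * X + C β) ^ n) (g z))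
      (H (n + 1) z * ((α * a + β * c) * z + (α * b + β * d)) ^ n) z := by
    intro α β
    have := hasDerivAt_pairing h.derivSeq
      (natDegree_linear_pow_le (α * a + β * c) (α * b + β * d) n) hz
    rw [show H (n + 1) z * ((α * a + β * c) * z + (α * b + β * d)) ^ n =
      H (n + 1) z * eval z ((C (α * a + β * c) * X + C (α * b + β * d)) ^ n) by simp]
    refine this.congr_of_eventuallyEq ?_
    filter_upwards [isOpen_im_pos.mem_nhds hz] with w hw
    exact h.pairing_linear_pow α β hw
  -- For this linear form the value at gz is 1/(cz + d), and its pullback under g is the constant 1.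
  have key := (hL (-c) a).unique (hR (-c) a)
  have e1 : -c * g z + a = 1 / (c * z + d) := by
    rw [h.map_eq z hz]
    field_simp
    linear_combination h.det
  have e2 : (-c * a + a * c) * z + (-c * b + a * d) = 1 := by linear_combination h.det
  rw [e1, e2] at key
  rw [one_pow, mul_one] at key
  rw [one_div_pow] at key
  rw [pow_add, ← key]
  field_simp

end Covariance

/-! ### Meromorphic continuation in u: existence and uniqueness of regularized values -/

section Continuation

open MeasureTheory Filter Topology Asymptotics

/-- The pullback of `exp (i u w) φ(w) dw` to the vertical ray `t ↦ z₀ + i t`. -/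
def expRay (φ : ℂ → ℂ) (z₀ u : ℂ) (t : ℝ) : ℂ :=
  exp (u * I * (z₀ + t * I)) * φ (z₀ + t * I) * I

/-- The function `u ↦ ∫ exp (i u w) φ(w) dw` on the vertical ray from `z₀` has a meromorphic
continuation `A / p` to the half-plane `-(2 π K + π) < Re u`, with real poles of absolute value at
least `π`, and with the value `v` at `0`. -/
def HasContinuation (K : ℕ) (φ : ℂ → ℂ) (z₀ v : ℂ) : Prop :=
  ∃ (r : ℝ) (p A : ℂ → ℂ), Differentiable ℂ p ∧
    (∀ u, p u = 0 → u.im = 0 ∧ Real.pi ≤ |u.re| ∧ u.re ≤ r) ∧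
    DifferentiableOn ℂ A {u | -(2 * Real.pi * K + Real.pi) < u.re} ∧
    (∀ u : ℂ, r < u.re → IntegrableOn (expRay φ z₀ u) (Set.Ioi 0) ∧
      A u = p u * ∫ t in Set.Ioi (0 : ℝ), expRay φ z₀ u t) ∧
    A 0 = p 0 * v

variable {K : ℕ} {φ ψ : ℂ → ℂ} {z₀ v w : ℂ}

/-- Fractions are added over the product of the denominators, whose zeros obey the same constraints.
-/
theorem HasContinuation.add (h₁ : HasContinuation K φ z₀ v) (h₂ : HasContinuation K ψ z₀ w) :
    HasContinuation K (fun z => φ z + ψ z) z₀ (v + w) := by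
  obtain ⟨r₁, p₁, A₁, hp₁, hr₁, hA₁, hi₁, hv₁⟩ := h₁
  obtain ⟨r₂, p₂, A₂, hp₂, hr₂, hA₂, hi₂, hv₂⟩ := h₂
  refine ⟨max r₁ r₂, fun u => p₁ u * p₂ u, fun u => A₁ u * p₂ u + p₁ u * A₂ u, hp₁.mul hp₂, ?_,
    (hA₁.mul hp₂.differentiableOn).add (hp₁.differentiableOn.mul hA₂), ?_, ?_⟩
  · intro u hu
    rcases mul_eq_zero.mp hu with h | h
    · exact ⟨(hr₁ u h).1, (hr₁ u h).2.1, (hr₁ u h).2.2.trans (le_max_left _ _)⟩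
    · exact ⟨(hr₂ u h).1, (hr₂ u h).2.1, (hr₂ u h).2.2.trans (le_max_right _ _)⟩
  · intro u hu
    obtain ⟨i₁, e₁⟩ := hi₁ u ((le_max_left _ _).trans_lt hu)
    obtain ⟨i₂, e₂⟩ := hi₂ u ((le_max_right _ _).trans_lt hu)
    have : expRay (fun z => φ z + ψ z) z₀ u = fun t => expRay φ z₀ u t + expRay ψ z₀ u t := by
      ext t
      simp only [expRay]
      ring
    rw [this]
    refine ⟨i₁.add i₂, ?_⟩
    beta_reduce
    rw [integral_add i₁ i₂, e₁, e₂]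
    ring
  · beta_reduce
    rw [hv₁, hv₂]
    ring

theorem HasContinuation.const_mul (c : ℂ) (h : HasContinuation K φ z₀ v) :
    HasContinuation K (fun z => c * φ z) z₀ (c * v) := by
  obtain ⟨r, p, A, hp, hr, hA, hi, hv⟩ := h
  refine ⟨r, p, fun u => c * A u, hp, hr, hA.const_mul c, fun u hu => ?_, by beta_reduce; rw [hv]; ring⟩
  obtain ⟨i₁, e₁⟩ := hi u hu
  have : expRay (fun z => c * φ z) z₀ u = fun t => c * expRay φ z₀ u t := by
    ext t
    simp only [expRay]
    ring
  rw [this]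
  refine ⟨i₁.const_mul c, ?_⟩
  beta_reduce
  rw [integral_const_mul, e₁]
  ring

theorem HasContinuation.zero : HasContinuation K (fun _ => 0) z₀ 0 := by
  refine ⟨0, fun _ => 1, fun _ => 0, differentiable_const _, by simp,
    differentiableOn_const _, fun u _ => ?_, by simp⟩
  have : expRay (fun _ => 0) z₀ u = fun _ => 0 := by
    ext t
    simp [expRay]
  rw [this]
  simp

theorem HasContinuation.sum {ι : Type*} (s : Finset ι) {φ : ι → ℂ → ℂ} {v : ι → ℂ}
    (h : ∀ i ∈ s, HasContinuation K (φ i) z₀ (v i)) :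
    HasContinuation K (fun z => ∑ i ∈ s, φ i z) z₀ (∑ i ∈ s, v i) := by
  classical
  induction s using Finset.induction_on with
  | empty => simpa using HasContinuation.zero
  | insert i s hi ih =>
    simp only [Finset.sum_insert hi]
    exact (h i (Finset.mem_insert_self i s)).add
      (ih fun j hj => h j (Finset.mem_insert_of_mem hj))

theorem HasContinuation.congr (hz₀ : 0 < z₀.im) (h : HasContinuation K φ z₀ v)
    (hφ : ∀ z : ℂ, 0 < z.im → φ z = ψ z) : HasContinuation K ψ z₀ v := by
  obtain ⟨r, p, A, hp, hr, hA, hi, hv⟩ := h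
  refine ⟨r, p, A, hp, hr, hA, fun u hu => ?_, hv⟩
  obtain ⟨i₁, e₁⟩ := hi u hu
  have : Set.EqOn (expRay φ z₀ u) (expRay ψ z₀ u) (Set.Ioi 0) := by
    intro t ht
    have ht' : (0 : ℝ) < t := ht
    simp only [expRay]
    rw [hφ]
    simpa using add_pos hz₀ ht'
  exact ⟨i₁.congr_fun this measurableSet_Ioi, by
    rw [e₁, setIntegral_congr_fun measurableSet_Ioi this]⟩

theorem isOpen_re_gt (a : ℝ) : IsOpen {u : ℂ | a < u.re} := isOpen_lt continuous_const continuous_re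

/-- All poles are real and at distance at least π from 0. A right half-plane is thus joined to the
strip around 0 through the upper half-plane, without meeting a pole. -/
theorem HasContinuation.hasRegIntegral {f : ℍ → ℂ} {z₀ : ℍ} {v : ℂ}
    (h : HasContinuation 0 (f ∘ UpperHalfPlane.ofComplex) z₀ v) : HasRegIntegral f z₀ v := by
  obtain ⟨r, p, A, hp, hr, hA, hi, hv⟩ := h
  have hπ := Real.pi_pos
  set r' := max r 0 with hr'
  have hrr : r ≤ r' := le_max_left _ _
  have hr0 : 0 ≤ r' := le_max_right _ _
  let U₁ : Set ℂ := {u | r' < u.re}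
  let U₂ : Set ℂ := {u | -Real.pi < u.re} ∩ {u | 0 < u.im}
  let U₃ : Set ℂ := {u | -Real.pi < u.re} ∩ {u | u.re < Real.pi}
  have hU₁ : Convex ℝ U₁ := convex_halfSpace_re_gt r'
  have hU₂ : Convex ℝ U₂ := (convex_halfSpace_re_gt _).inter (convex_halfSpace_im_gt _)
  have hU₃ : Convex ℝ U₃ := (convex_halfSpace_re_gt _).inter (convex_halfSpace_re_lt _)
  have hopen : IsOpen (U₁ ∪ (U₂ ∪ U₃)) :=
    (isOpen_re_gt _).union (((isOpen_re_gt _).inter isOpen_im_pos).union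
      ((isOpen_re_gt _).inter (isOpen_lt continuous_re continuous_const)))
  have hne : ∀ u ∈ U₁ ∪ (U₂ ∪ U₃), p u ≠ 0 := by
    intro u hu h0
    obtain ⟨h1, h2, h3⟩ := hr u h0
    rcases hu with hu | hu | hu
    · have : r' < u.re := hu
      linarith
    · have : 0 < u.im := hu.2
      linarith
    · have h4 : -Real.pi < u.re := hu.1
      have h5 : u.re < Real.pi := hu.2
      have := abs_lt.mpr ⟨h4, h5⟩
      linarith
  have hsub : U₁ ∪ (U₂ ∪ U₃) ⊆ {u : ℂ | -(2 * Real.pi * (0 : ℕ) + Real.pi) < u.re} := by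
    intro u hu
    simp only [Set.mem_ofPred_eq, Nat.cast_zero, mul_zero, zero_add]
    rcases hu with hu | hu | hu
    · have : r' < u.re := hu
      linarith
    · exact hu.1
    · exact hu.1
  refine ⟨r', U₁ ∪ (U₂ ∪ U₃), fun u => A u / p u, hopen, ?_, Set.subset_union_left, ?_, ?_, ?_, ?_⟩
  · refine IsPreconnected.union (r' + 1 + I : ℂ) (by simp [U₁])
      (Or.inl ⟨by simp; linarith, by simp⟩) hU₁.isPreconnected ?_
    exact IsPreconnected.union (I : ℂ) ⟨by simpa using hπ, by simp⟩
      ⟨by simpa using hπ, by simpa using hπ⟩ hU₂.isPreconnected hU₃.isPreconnected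
  · exact Or.inr (Or.inr ⟨by simpa using hπ, by simpa using hπ⟩)
  · refine DifferentiableOn.analyticOnNhd ?_ hopen
    exact (hA.mono hsub).div hp.differentiableOn hne
  · intro u hu
    obtain ⟨i₁, e₁⟩ := hi u (hrr.trans_lt hu)
    refine ⟨i₁, ?_⟩
    beta_reduce
    rw [e₁, mul_div_cancel_left₀ _ (hne u (Or.inl hu))]
    rfl
  · have h0 : p 0 ≠ 0 := hne 0 (Or.inr (Or.inr ⟨by simpa using hπ, by simpa using hπ⟩))
    beta_reduce
    rw [hv, mul_div_cancel_left₀ _ h0]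

/-- The domain U of the given continuation is arbitrary and may reach 0 only through a detour far to
the left. A path in U from 0 to the right is compact, so some K covers it; the identity theorem for
pΦ and A on a component of U cut by that half-plane then compares the values at 0. -/
theorem HasRegIntegral.eq_of_hasContinuation {f : ℍ → ℂ} {z₀ : ℍ} {v v' : ℂ}
    (hf : HasRegIntegral f z₀ v')
    (h : ∀ K, HasContinuation K (f ∘ UpperHalfPlane.ofComplex) z₀ v) : v' = v := by
  obtain ⟨r₁, U, Φ, hU, hUc, hrU, h0U, hΦ, hint, rfl⟩ := hf
  have hπ := Real.pi_pos
  obtain ⟨x, hx⟩ : ∃ x : ℝ, max r₁ 0 < x := ⟨max r₁ 0 + 1, by linarith⟩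
  have hxU : (x : ℂ) ∈ U := hrU (by simpa using (le_max_left r₁ 0).trans_lt hx)
  have hpc : IsPathConnected U := hU.isConnected_iff_isPathConnected.mp ⟨⟨0, h0U⟩, hUc⟩
  obtain ⟨γ, hγ⟩ := hpc.joinedIn 0 h0U x hxU
  have hcomp : IsCompact (Set.range γ) := isCompact_range γ.continuous
  obtain ⟨B, hB⟩ := hcomp.isBounded.exists_norm_le
  obtain ⟨K, hK⟩ := exists_nat_gt B
  let V : Set ℂ := U ∩ {u | -(2 * Real.pi * K + Real.pi) < u.re}
  have hV : IsOpen V := hU.inter (isOpen_re_gt _)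
  have hγV : Set.range γ ⊆ V := by
    rintro _ ⟨t, rfl⟩
    refine ⟨hγ t, ?_⟩
    have h1 := hB (γ t) ⟨t, rfl⟩
    have h2 := (abs_le.mp ((abs_re_le_norm (γ t)).trans h1)).1
    have h3 : (K : ℝ) ≤ 2 * Real.pi * K := by
      have := Real.pi_gt_three
      have hK0 : (0 : ℝ) ≤ K := Nat.cast_nonneg K
      nlinarith
    show -(2 * Real.pi * K + Real.pi) < (γ t).re
    linarith
  have h0 : (0 : ℂ) ∈ Set.range γ := ⟨0, γ.source⟩
  have h1 : (x : ℂ) ∈ Set.range γ := ⟨1, γ.target⟩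
  let W := connectedComponentIn V 0
  have hWV : W ⊆ V := connectedComponentIn_subset V 0
  have hxW : (x : ℂ) ∈ W :=
    (isPreconnected_range γ.continuous).subset_connectedComponentIn h0 hγV h1
  have h0W : (0 : ℂ) ∈ W := mem_connectedComponentIn (hγV h0)
  have hWo : IsOpen W := hV.connectedComponentIn
  obtain ⟨r, p, A, hp, hr, hA, hi, hv⟩ := h K
  have hA' : AnalyticOnNhd ℂ A W :=
    (hA.analyticOnNhd (isOpen_re_gt _)).mono fun u hu => (hWV hu).2
  have hP' : AnalyticOnNhd ℂ (fun u => p u * Φ u) W :=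
    (hp.differentiableOn.analyticOnNhd hWo).mul (hΦ.mono fun u hu => (hWV hu).1)
  obtain ⟨y, hy⟩ : ∃ y : ℝ, max (max r₁ 0) r < y := ⟨max (max r₁ 0) r + 1, by linarith⟩
  have hKπ : 0 ≤ 2 * Real.pi * K := by positivity
  have hhalf : {u : ℂ | max r₁ 0 < u.re} ⊆ V := by
    intro u hu
    have hu' : max r₁ 0 < u.re := hu
    refine ⟨hrU ((le_max_left r₁ 0).trans_lt hu'), ?_⟩
    have := (le_max_right r₁ 0).trans_lt hu'
    show -(2 * Real.pi * K + Real.pi) < u.re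
    linarith
  have hyW : (y : ℂ) ∈ W := by
    have := (convex_halfSpace_re_gt (max r₁ 0)).isPreconnected.subset_connectedComponentIn
      (x := (x : ℂ)) (by simpa using hx) hhalf
    rw [← connectedComponentIn_eq hxW] at this
    exact this (by simpa using (le_max_left _ _).trans_lt hy)
  have hev : (fun u => p u * Φ u) =ᶠ[𝓝 (y : ℂ)] A := by
    have hmem : {u : ℂ | max (max r₁ 0) r < u.re} ∈ 𝓝 (y : ℂ) :=
      (isOpen_re_gt _).mem_nhds (by simpa using hy)
    filter_upwards [hmem] with u hu
    have hu' : max (max r₁ 0) r < u.re := hu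
    rw [(hi u ((le_max_right _ _).trans_lt hu')).2,
      (hint u (((le_max_left r₁ 0).trans (le_max_left _ r)).trans_lt hu')).2]
    rfl
  have hEq := hP'.eqOn_of_preconnected_of_eventuallyEq hA' isPreconnected_connectedComponentIn
    hyW hev h0W
  have hp0 : p 0 ≠ 0 := by
    intro h
    have := (hr 0 h).2.1
    simp only [zero_re, abs_zero] at this
    linarith
  have hEq' : p 0 * Φ 0 = A 0 := hEq
  rw [hv] at hEq'
  exact mul_left_cancel₀ hp0 hEq'

end Continuation

/-! ### Regularized integrals of exponentials times polynomials -/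

section ExponentialTerms

open MeasureTheory Filter Topology Asymptotics Polynomial

/-- The successive derivatives of `z ↦ exp (μ z)`. -/
def expSeq (μ : ℂ) (m : ℕ) (z : ℂ) : ℂ := μ ^ m * exp (μ * z)

theorem hasDerivAt_expSeq (μ : ℂ) (m : ℕ) (z : ℂ) :
    HasDerivAt (expSeq μ m) (expSeq μ (m + 1) z) z := by
  have h1 : HasDerivAt (fun z => exp (μ * z)) (exp (μ * z) * (μ * 1)) z :=
    ((hasDerivAt_id z).const_mul μ).cexp
  refine (h1.const_mul (μ ^ m)).congr_deriv ?_
  simp only [expSeq, pow_succ]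
  ring

theorem isDerivSeq_expSeq (μ : ℂ) : IsDerivSeq (expSeq μ) := fun m z _ => hasDerivAt_expSeq μ m z

theorem hasDerivAt_ray (z₀ : ℂ) (t : ℝ) : HasDerivAt (fun t : ℝ => z₀ + t * I) I t := by
  simpa using ((hasDerivAt_id t).ofReal_comp.mul_const I).const_add z₀

theorem eval_ray_isBigO (P : ℂ[X]) (z₀ : ℂ) {δ : ℝ} (hδ : 0 < δ) :
    (fun t : ℝ => P.eval (z₀ + t * I)) =O[atTop] fun t => Real.exp (δ * t) := by
  have hlin : ∀ n : ℕ, (fun t : ℝ => (z₀ + t * I) ^ n) =O[atTop] fun t : ℝ => t ^ n := by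
    intro n
    refine IsBigO.pow ?_ n
    refine IsBigO.add ?_ ?_
    · refine IsBigO.of_bound ‖z₀‖ ?_
      filter_upwards [eventually_ge_atTop 1] with t ht
      rw [Real.norm_eq_abs, abs_of_nonneg (by linarith)]
      exact le_mul_of_one_le_right (norm_nonneg _) ht
    · refine IsBigO.of_bound 1 (Eventually.of_forall fun t => ?_)
      simp
  simp only [eval_eq_sum_range]
  refine IsBigO.fun_sum fun i _ => ?_
  refine ((hlin i).const_mul_left _).trans ?_
  exact (isLittleO_pow_exp_pos_mul_atTop i hδ).isBigO

theorem exp_mul_eval_ray_isBigO (P : ℂ[X]) (z₀ : ℂ) {μ : ℂ} (hμ : 0 < μ.im) :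
    (fun t : ℝ => exp (μ * (z₀ + t * I)) * P.eval (z₀ + t * I)) =O[atTop]
      fun t => Real.exp (-(μ.im / 2) * t) := by
  have h1 : (fun t : ℝ => exp (μ * (z₀ + t * I))) =O[atTop] fun t => Real.exp (-μ.im * t) := by
    refine IsBigO.of_bound (Real.exp ((μ * z₀).re)) (Eventually.of_forall fun t => ?_)
    rw [norm_exp, Real.norm_eq_abs, Real.abs_exp, ← Real.exp_add]
    refine le_of_eq (congrArg _ ?_)
    simp
    ring
  refine (h1.mul (eval_ray_isBigO P z₀ (half_pos hμ))).congr_right fun t => ?_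
  rw [← Real.exp_add]
  congr 1
  ring

theorem exp_mul_eval_ray_integrableOn (P : ℂ[X]) (z₀ : ℂ) {μ : ℂ} (hμ : 0 < μ.im) :
    IntegrableOn (fun t : ℝ => exp (μ * (z₀ + t * I)) * P.eval (z₀ + t * I)) (Set.Ioi 0) := by
  have hc : Continuous fun t : ℝ => exp (μ * (z₀ + t * I)) * P.eval (z₀ + t * I) := by fun_prop
  refine (integrable_norm_iff hc.aestronglyMeasurable).mp ?_
  exact integrable_of_isBigO_exp_neg (half_pos hμ) hc.norm.continuousOn
    (exp_mul_eval_ray_isBigO P z₀ hμ).norm_left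

theorem exp_mul_eval_ray_tendsto (P : ℂ[X]) (z₀ : ℂ) {μ : ℂ} (hμ : 0 < μ.im) :
    Tendsto (fun t : ℝ => exp (μ * (z₀ + t * I)) * P.eval (z₀ + t * I)) atTop (𝓝 0) := by
  refine (exp_mul_eval_ray_isBigO P z₀ hμ).trans_tendsto ?_
  have : Tendsto (fun t : ℝ => μ.im / 2 * t) atTop atTop :=
    tendsto_id.const_mul_atTop (half_pos hμ)
  refine (Real.tendsto_exp_neg_atTop_nhds_zero.comp this).congr fun t => ?_
  simp

theorem pairing_expSeq (n : ℕ) (μ : ℂ) (P : ℂ[X]) (z : ℂ) :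
    pairing n (expSeq μ) P z = exp (μ * z) *
      (∑ j ∈ Finset.range (n + 1), C ((-1) ^ j * μ ^ (n - j)) * derivative^[j] P).eval z := by
  rw [pairing, eval_finsetSum, Finset.mul_sum]
  refine Finset.sum_congr rfl fun j _ => ?_
  simp only [expSeq, eval_mul, eval_C]
  ring

theorem integral_exp_mul_eval_ray {n : ℕ} {P : ℂ[X]} (hP : P.natDegree ≤ n) {z₀ : ℂ}
    (hz₀ : 0 < z₀.im) {μ : ℂ} (hμ : 0 < μ.im) :
    μ ^ (n + 1) * ∫ t in Set.Ioi (0 : ℝ), exp (μ * (z₀ + t * I)) * P.eval (z₀ + t * I) * I =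
      -pairing n (expSeq μ) P z₀ := by
  have hd : ∀ t ∈ Set.Ici (0 : ℝ), HasDerivAt (fun t : ℝ => pairing n (expSeq μ) P (z₀ + t * I))
      (μ ^ (n + 1) * (exp (μ * (z₀ + t * I)) * P.eval (z₀ + t * I) * I)) t := by
    intro t ht
    have him : 0 < (z₀ + t * I).im := by
      have : (0 : ℝ) ≤ t := ht
      simpa using add_pos_of_pos_of_nonneg hz₀ this
    refine ((hasDerivAt_pairing (isDerivSeq_expSeq μ) hP him).comp t
      (hasDerivAt_ray z₀ t)).congr_deriv ?_
    simp only [expSeq]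
    ring
  have hi := ((exp_mul_eval_ray_integrableOn P z₀ hμ).mul_const I).const_mul (μ ^ (n + 1))
  have ht : Tendsto (fun t : ℝ => pairing n (expSeq μ) P (z₀ + t * I)) atTop (𝓝 0) := by
    simp only [pairing_expSeq]
    exact exp_mul_eval_ray_tendsto _ z₀ hμ
  have := integral_Ioi_of_hasDerivAt_of_tendsto' hd hi ht
  rw [integral_const_mul] at this
  simpa using this

/-- The factor exp(iuw) shifts the frequency κ to κ + iu, so the integral is an entire function of u
over (κ + iu)^(n+1). The only possible pole is u = -2πi', with i' the index `i`, and `hi` keeps it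
away from 0. -/
theorem hasContinuation_expSeq (K : ℕ) {n : ℕ} {P : ℂ[X]} (hP : P.natDegree ≤ n) {z₀ : ℂ}
    (hz₀ : 0 < z₀.im) {i : ℤ} (hi : i ≠ 0) :
    HasContinuation K (fun z => expSeq (2 * Real.pi * I * i) (n + 1) z * P.eval z) z₀
      (-pairing n (expSeq (2 * Real.pi * I * i)) P z₀) := by
  have hπ := Real.pi_pos
  set κ : ℂ := 2 * Real.pi * I * i with hκ
  have hκ0 : κ ≠ 0 := by
    simp [hκ, hi, hπ.ne']
  have hκim : κ.im = 2 * Real.pi * i := by simp [hκ]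
  have hκre : κ.re = 0 := by simp [hκ]
  have hcont : HasContinuation K (fun z => exp (κ * z) * P.eval z) z₀
      (-(κ ^ (n + 1))⁻¹ * pairing n (expSeq κ) P z₀) := by
    refine ⟨2 * Real.pi * |(i : ℝ)|, fun u => (u * I + κ) ^ (n + 1),
      fun u => -pairing n (expSeq (u * I + κ)) P z₀, by fun_prop, ?_, ?_, ?_, ?_⟩
    · intro u hu
      have h0 : u * I + κ = 0 := by simpa using hu
      have hre := congrArg re h0
      have him := congrArg im h0
      simp only [add_re, add_im, mul_re, mul_im, I_re, I_im, hκim, hκre, zero_re, zero_im, mul_zero,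
        mul_one, zero_sub, add_zero] at hre him
      have hur : u.re = -(2 * Real.pi * i) := by linarith
      have h1 : (1 : ℝ) ≤ |(i : ℝ)| := by exact_mod_cast Int.one_le_abs hi
      refine ⟨by linarith, ?_, ?_⟩
      · rw [hur, abs_neg, abs_mul, abs_of_pos (by positivity)]
        nlinarith
      · rw [hur]
        have := neg_le_abs (i : ℝ)
        nlinarith
    · simp only [pairing, expSeq]
      refine Differentiable.differentiableOn ?_
      fun_prop
    · intro u hu
      have hμ : 0 < (u * I + κ).im := by
        simp only [add_im, mul_im, I_re, I_im, hκim]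
        have := neg_abs_le (i : ℝ)
        nlinarith
      have hray : expRay (fun z => exp (κ * z) * P.eval z) z₀ u =
          fun t : ℝ => exp ((u * I + κ) * (z₀ + t * I)) * P.eval (z₀ + t * I) * I := by
        ext t
        rw [expRay, add_mul (u * I), exp_add]
        ring
      rw [hray]
      exact ⟨(exp_mul_eval_ray_integrableOn P z₀ hμ).mul_const I,
        (integral_exp_mul_eval_ray hP hz₀ hμ).symm⟩
    · simp only [zero_mul, zero_add]
      field_simp
  have := hcont.const_mul (κ ^ (n + 1))
  have e : κ ^ (n + 1) * (-(κ ^ (n + 1))⁻¹ * pairing n (expSeq κ) P z₀) =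
      -pairing n (expSeq κ) P z₀ := by
    field_simp
  rw [e] at this
  exact this.congr hz₀ fun z _ => by simp only [expSeq]; ring

end ExponentialTerms

/-! ### Exponentially decaying tails -/

section Tail

open MeasureTheory Filter Topology Asymptotics Polynomial

/-- The integral itself converges and is holomorphic on the whole half-plane, so the denominator is
1. -/
theorem hasContinuation_of_exp_decay (K : ℕ) {ψ : ℂ → ℂ} {z₀ : ℂ}
    (hc : ContinuousOn (fun t : ℝ => ψ (z₀ + t * I)) (Set.Ici 0)) {B : ℝ}
    (hB : ∀ t : ℝ, 0 ≤ t →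
      ‖ψ (z₀ + t * I)‖ ≤ B * Real.exp (-(2 * Real.pi * K + Real.pi) * t)) :
    HasContinuation K ψ z₀ (∫ t in Set.Ioi (0 : ℝ), ψ (z₀ + t * I) * I) := by
  set a : ℝ := 2 * Real.pi * K + Real.pi with ha
  have ha0 : 0 < a := by positivity
  have hmeas : ∀ u, AEStronglyMeasurable (expRay ψ z₀ u) (volume.restrict (Set.Ioi 0)) := by
    intro u
    refine ContinuousOn.aestronglyMeasurable ?_ measurableSet_Ioi
    refine ContinuousOn.mul (ContinuousOn.mul ?_ (hc.mono Set.Ioi_subset_Ici_self))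
      continuousOn_const
    fun_prop
  have hB0 : 0 ≤ B := by
    have := (norm_nonneg _).trans (hB 0 le_rfl)
    simpa using this
  have hnorm : ∀ u : ℂ, ∀ t : ℝ, 0 ≤ t → ‖expRay ψ z₀ u t‖ ≤
      Real.exp (‖u‖ * ‖z₀‖) * B * Real.exp (-(u.re + a) * t) := by
    intro u t ht
    rw [expRay, norm_mul, norm_mul, norm_I, mul_one, norm_exp]
    have h1 : (u * I * (z₀ + t * I)).re ≤ ‖u‖ * ‖z₀‖ + -u.re * t := by
      have h2 : (u * I * (z₀ + t * I)).re = (u * I * z₀).re + -u.re * t := by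
        simp
        ring
      rw [h2]
      have h3 := re_le_norm (u * I * z₀)
      rw [norm_mul, norm_mul, norm_I, mul_one] at h3
      linarith
    calc Real.exp (u * I * (z₀ + t * I)).re * ‖ψ (z₀ + t * I)‖
        ≤ Real.exp (‖u‖ * ‖z₀‖ + -u.re * t) * (B * Real.exp (-a * t)) :=
          mul_le_mul (Real.exp_le_exp.mpr h1) (hB t ht) (norm_nonneg _) (Real.exp_nonneg _)
      _ = _ := by
          rw [Real.exp_add, show -(u.re + a) * t = -u.re * t + -a * t by ring, Real.exp_add]
          ring
  have hint : ∀ u : ℂ, -a < u.re → IntegrableOn (expRay ψ z₀ u) (Set.Ioi 0) := by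
    intro u hu
    refine Integrable.mono' ((exp_neg_integrableOn_Ioi 0
      (show 0 < u.re + a by linarith)).const_mul (Real.exp (‖u‖ * ‖z₀‖) * B)) (hmeas u) ?_
    refine (ae_restrict_mem measurableSet_Ioi).mono fun t ht => ?_
    exact hnorm u t (le_of_lt ht)
  refine ⟨-a, fun _ => 1, fun u => ∫ t in Set.Ioi (0 : ℝ), expRay ψ z₀ u t,
    differentiable_const _, by simp, ?_, fun u hu => ⟨hint u hu, by simp⟩, ?_⟩
  · intro u₀ hu₀
    have hu₀' : -a < u₀.re := hu₀
    -- On the δ-ball the integrand still decays like exp(-δt); half of this rate absorbs the linear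
    -- factor produced by differentiating in u.
    obtain ⟨δ, hδ⟩ : ∃ δ, δ = (u₀.re + a) / 2 := ⟨_, rfl⟩
    have hδ0 : 0 < δ := by linarith
    have hball : Metric.ball u₀ δ ∈ 𝓝 u₀ := Metric.ball_mem_nhds _ hδ0
    refine (hasDerivAt_integral_of_dominated_loc_of_deriv_le (s := Metric.ball u₀ δ)
      (F' := fun u t => I * (z₀ + t * I) * expRay ψ z₀ u t)
      (bound := fun t => (‖z₀‖ + 2 / δ) * (Real.exp ((‖u₀‖ + δ) * ‖z₀‖) * B) *
        Real.exp (-(δ / 2) * t)) hball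
      (Eventually.of_forall hmeas) (hint u₀ hu₀') ?_ ?_ ?_ ?_).2.differentiableAt.differentiableWithinAt
    · exact (Continuous.aestronglyMeasurable (by fun_prop)).mul (hmeas u₀)
    · refine (ae_restrict_mem measurableSet_Ioi).mono fun t ht u hu => ?_
      have ht0 : 0 ≤ t := le_of_lt ht
      have hd : ‖u - u₀‖ < δ := by simpa [dist_eq_norm] using hu
      have hun : ‖u‖ ≤ ‖u₀‖ + δ := by
        have := norm_add_le u₀ (u - u₀)
        rw [add_sub_cancel] at this
        linarith
      have hre : δ ≤ u.re + a := by
        have h1 := (abs_le.mp ((abs_re_le_norm (u - u₀)))).1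
        rw [sub_re] at h1
        linarith
      have h1 : ‖I * (z₀ + t * I)‖ ≤ (‖z₀‖ + 2 / δ) * Real.exp (δ / 2 * t) := by
        rw [norm_mul, norm_I, one_mul]
        have h2 : ‖z₀ + t * I‖ ≤ ‖z₀‖ + t := by
          refine (norm_add_le _ _).trans ?_
          simp [abs_of_nonneg ht0]
        have h3 := Real.add_one_le_exp (δ / 2 * t)
        have h4 : 1 ≤ Real.exp (δ / 2 * t) := Real.one_le_exp (by positivity)
        have h5 : t ≤ 2 / δ * Real.exp (δ / 2 * t) := by
          have : t = 2 / δ * (δ / 2 * t) := by field_simp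
          calc t = 2 / δ * (δ / 2 * t) := this
            _ ≤ _ := by
              refine mul_le_mul_of_nonneg_left ?_ (by positivity)
              linarith
        have h6 : ‖z₀‖ ≤ ‖z₀‖ * Real.exp (δ / 2 * t) := le_mul_of_one_le_right (norm_nonneg _) h4
        rw [add_mul]
        linarith
      have h2 : ‖expRay ψ z₀ u t‖ ≤
          Real.exp ((‖u₀‖ + δ) * ‖z₀‖) * B * Real.exp (-δ * t) := by
        refine (hnorm u t ht0).trans ?_
        gcongr
      calc ‖I * (z₀ + t * I) * expRay ψ z₀ u t‖
          ≤ ((‖z₀‖ + 2 / δ) * Real.exp (δ / 2 * t)) *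
            (Real.exp ((‖u₀‖ + δ) * ‖z₀‖) * B * Real.exp (-δ * t)) := by
            rw [norm_mul]
            exact mul_le_mul h1 h2 (norm_nonneg _) (by positivity)
        _ = _ := by
            rw [show -(δ / 2) * t = δ / 2 * t + -δ * t by ring, Real.exp_add]
            ring
    · exact (exp_neg_integrableOn_Ioi 0 (half_pos hδ0)).const_mul _
    · refine Eventually.of_forall fun t u _ => ?_
      have h1 : HasDerivAt (fun u => exp (u * I * (z₀ + t * I)))
          (exp (u * I * (z₀ + t * I)) * (1 * I * (z₀ + t * I))) u :=
        (((hasDerivAt_id u).mul_const I).mul_const _).cexp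
      refine ((h1.mul_const (ψ (z₀ + t * I))).mul_const I).congr_deriv ?_
      simp only [expRay]
      ring
  · simp [expRay]

/-- The regularized integral for a sequence of derivatives decaying exponentially along the vertical
ray from `z₀`. -/
theorem IsDerivSeq.hasContinuation_of_exp_decay (K : ℕ) {n : ℕ} {H : ℕ → ℂ → ℂ}
    (hH : IsDerivSeq H) {P : ℂ[X]} (hP : P.natDegree ≤ n) {z₀ : ℂ} (hz₀ : 0 < z₀.im)
    (hB : ∀ m, ∃ B : ℝ, ∀ t : ℝ, 0 ≤ t →
      ‖H m (z₀ + t * I)‖ ≤ B * Real.exp (-(2 * Real.pi * (K + 1)) * t)) :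
    HasContinuation K (fun z => H (n + 1) z * P.eval z) z₀ (-pairing n H P z₀) := by
  have hπ := Real.pi_pos
  have him : ∀ t : ℝ, 0 ≤ t → 0 < (z₀ + t * I).im := fun t ht => by
    simpa using add_pos_of_pos_of_nonneg hz₀ ht
  have hcH : ∀ m, ContinuousOn (fun t : ℝ => H m (z₀ + t * I)) (Set.Ici 0) := by
    intro m t ht
    exact ((hH m _ (him t ht)).comp t (hasDerivAt_ray z₀ t)).continuousAt.continuousWithinAt
  have hbd : ∀ m, ∀ R : ℂ[X], ∃ B : ℝ, ∀ t : ℝ, 0 ≤ t →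
      ‖H m (z₀ + t * I) * R.eval (z₀ + t * I)‖ ≤
        B * Real.exp (-(2 * Real.pi * K + Real.pi) * t) := by
    intro m R
    obtain ⟨B, hB⟩ := hB m
    -- The growth exp(πt) allowed to the polynomial is the margin between the decay rates 2π(K + 1)
    -- and 2πK + π.
    obtain ⟨B', hB'⟩ : ∃ B' : ℝ, ∀ t : ℝ, 0 ≤ t →
        ‖R.eval (z₀ + t * I)‖ ≤ B' * Real.exp (Real.pi * t) := by
      have hO := (eval_ray_isBigO R z₀ hπ)
      obtain ⟨c, hc⟩ := hO.bound
      obtain ⟨T, hT⟩ := eventually_atTop.mp hc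
      obtain ⟨M, hM⟩ := (isCompact_Icc (a := (0 : ℝ)) (b := T)).exists_bound_of_continuousOn
        (f := fun t : ℝ => R.eval (z₀ + t * I)) (by fun_prop)
      refine ⟨max c M, fun t ht => ?_⟩
      rcases le_total T t with h | h
      · have := hT t h
        rw [Real.norm_eq_abs, Real.abs_exp] at this
        exact this.trans (mul_le_mul_of_nonneg_right (le_max_left _ _) (Real.exp_nonneg _))
      · have h1 := hM t ⟨ht, h⟩
        have h2 : 1 ≤ Real.exp (Real.pi * t) := Real.one_le_exp (by positivity)
        have h3 : 0 ≤ max c M := ((norm_nonneg _).trans h1).trans (le_max_right _ _)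
        exact (h1.trans (le_max_right c M)).trans (le_mul_of_one_le_right h3 h2)
    refine ⟨B * B', fun t ht => ?_⟩
    rw [norm_mul]
    calc _ ≤ (B * Real.exp (-(2 * Real.pi * (K + 1)) * t)) * (B' * Real.exp (Real.pi * t)) :=
          mul_le_mul (hB t ht) (hB' t ht) (norm_nonneg _) ((norm_nonneg _).trans (hB t ht))
      _ = _ := by
          rw [show -(2 * Real.pi * K + Real.pi) * t =
            -(2 * Real.pi * (K + 1)) * t + Real.pi * t by ring, Real.exp_add]
          ring
  obtain ⟨B, hB1⟩ := hbd (n + 1) P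
  have hcψ : ContinuousOn (fun t : ℝ => H (n + 1) (z₀ + t * I) * P.eval (z₀ + t * I))
      (Set.Ici 0) := (hcH (n + 1)).mul (by fun_prop)
  have hcont := CycleIntegral.hasContinuation_of_exp_decay K
    (ψ := fun z => H (n + 1) z * P.eval z) hcψ hB1
  have ha : 0 < 2 * Real.pi * K + Real.pi := by positivity
  have hint : IntegrableOn (fun t : ℝ => H (n + 1) (z₀ + t * I) * P.eval (z₀ + t * I) * I)
      (Set.Ioi 0) := by
    refine Integrable.mul_const ?_ I
    refine Integrable.mono' ((exp_neg_integrableOn_Ioi 0 ha).const_mul B)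
      ((hcψ.mono Set.Ioi_subset_Ici_self).aestronglyMeasurable measurableSet_Ioi) ?_
    exact (ae_restrict_mem measurableSet_Ioi).mono fun t ht => hB1 t (le_of_lt ht)
  have hexp : Tendsto (fun t : ℝ => Real.exp (-(2 * Real.pi * K + Real.pi) * t)) atTop (𝓝 0) := by
    have : Tendsto (fun t : ℝ => (2 * Real.pi * K + Real.pi) * t) atTop atTop :=
      tendsto_id.const_mul_atTop ha
    refine (Real.tendsto_exp_neg_atTop_nhds_zero.comp this).congr fun t => ?_
    simp only [Function.comp_apply]
    ring_nf
  have ht : Tendsto (fun t : ℝ => pairing n H P (z₀ + t * I)) atTop (𝓝 0) := by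
    simp only [pairing]
    rw [← Finset.sum_const_zero (s := Finset.range (n + 1))]
    refine tendsto_finsetSum _ fun j _ => ?_
    obtain ⟨B, hB2⟩ := hbd (n - j) (derivative^[j] P)
    refine squeeze_zero_norm' (a := fun t =>
      B * Real.exp (-(2 * Real.pi * K + Real.pi) * t)) ?_ (by simpa using hexp.const_mul B)
    filter_upwards [eventually_ge_atTop 0] with t ht
    have := hB2 t ht
    rw [mul_assoc, norm_mul, norm_pow, norm_neg, norm_one, one_pow, one_mul]
    exact this
  have hd : ∀ t ∈ Set.Ici (0 : ℝ), HasDerivAt (fun t : ℝ => pairing n H P (z₀ + t * I))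
      (H (n + 1) (z₀ + t * I) * P.eval (z₀ + t * I) * I) t := by
    intro t ht
    have := (hasDerivAt_pairing hH hP (him t ht)).comp t (hasDerivAt_ray z₀ t)
    exact this
  have := integral_Ioi_of_hasDerivAt_of_tendsto' hd hint ht
  simp only [ofReal_zero, zero_mul, add_zero, zero_sub] at this
  rw [← this]
  exact hcont

end Tail

/-! ### The q-expansion and termwise regularized integration -/

section QExpansion

open MeasureTheory Filter Topology Asymptotics Polynomial Derivative

/-- The iterated derivatives of `G`, as functions on `ℂ`. -/
def iterDeriv (G : ℍ → ℂ) (m : ℕ) (z : ℂ) : ℂ :=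
  (2 * Real.pi * I) ^ m * (normalizedDerivOfComplex^[m] G) (UpperHalfPlane.ofComplex z)

theorem mdifferentiable_iterate {G : ℍ → ℂ} (hG : MDifferentiable 𝓘(ℂ) 𝓘(ℂ) G) (m : ℕ) :
    MDifferentiable 𝓘(ℂ) 𝓘(ℂ) (normalizedDerivOfComplex^[m] G) := by
  induction m with
  | zero => exact hG
  | succ m ih =>
    rw [Function.iterate_succ_apply']
    exact normalizedDerivOfComplex_mdifferentiable ih

theorem isDerivSeq_iterDeriv {G : ℍ → ℂ} (hG : MDifferentiable 𝓘(ℂ) 𝓘(ℂ) G) :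
    IsDerivSeq (iterDeriv G) := by
  intro m z hz
  have h1 := UpperHalfPlane.mdifferentiableAt_iff.mp (mdifferentiable_iterate hG m ⟨z, hz⟩)
  have h2 := (h1.hasDerivAt).const_mul ((2 * Real.pi * I) ^ m)
  refine h2.congr_deriv ?_
  have h3 : (2 * Real.pi * I : ℂ) ≠ 0 := two_pi_I_ne_zero
  simp only [iterDeriv]
  rw [Function.iterate_succ_apply', normalizedDerivOfComplex,
    UpperHalfPlane.ofComplex_apply_of_im_pos hz, pow_succ]
  field_simp

/-- The iterated Taylor quotients at `0`. -/
def taylorQuotient (g : ℂ → ℂ) (m : ℕ) : ℂ → ℂ := (fun f => dslope f 0)^[m] g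

theorem taylorQuotient_succ (g : ℂ → ℂ) (m : ℕ) (q : ℂ) :
    taylorQuotient g m q = taylorQuotient g m 0 + q * taylorQuotient g (m + 1) q := by
  simp only [taylorQuotient, Function.iterate_succ_apply']
  have := sub_smul_dslope ((fun f => dslope f 0)^[m] g) 0 q
  simp only [sub_zero, smul_eq_mul] at this
  rw [this]
  ring

theorem eq_sum_add_taylorQuotient (g : ℂ → ℂ) (M : ℕ) (q : ℂ) :
    g q = ∑ i ∈ Finset.range M, taylorQuotient g i 0 * q ^ i + q ^ M * taylorQuotient g M q := by
  induction M with
  | zero => simp [taylorQuotient]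
  | succ M ih =>
    rw [Finset.sum_range_succ, ih, taylorQuotient_succ g M q, pow_succ]
    ring

theorem differentiableOn_taylorQuotient {g : ℂ → ℂ}
    (hg : DifferentiableOn ℂ g (Metric.ball 0 1)) (m : ℕ) :
    DifferentiableOn ℂ (taylorQuotient g m) (Metric.ball 0 1) := by
  induction m with
  | zero => exact hg
  | succ m ih =>
    simp only [taylorQuotient, Function.iterate_succ_apply'] at ih ⊢
    exact (Complex.differentiableOn_dslope (Metric.ball_mem_nhds _ one_pos)).mpr ih

/-- Invariance under `ModularGroup.T` makes q^N G a function of q, and its boundedness at the cusp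
removes the singularity at q = 0. -/
theorem IsWeaklyHolomorphic.exists_qExpansion {w : ℤ} {G : ℍ → ℂ} (hG : IsWeaklyHolomorphic w G) :
    ∃ (N : ℕ) (g : ℂ → ℂ), DifferentiableOn ℂ g (Metric.ball 0 1) ∧
      ∀ z : ℂ, 0 < z.im → exp (2 * Real.pi * I * z) ^ N * G (UpperHalfPlane.ofComplex z) =
        g (exp (2 * Real.pi * I * z)) := by
  obtain ⟨N, hN⟩ := hG.meromorphic_at_cusp
  set f : ℍ → ℂ := fun z => exp (2 * Real.pi * I * z) ^ N * G z with hf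
  have hT : ∀ z : ℍ, G ((1 : ℝ) +ᵥ z) = G z := by
    intro z
    have := congrFun (hG.slash_eq ModularGroup.T) z
    rw [ModularForm.SL_slash_apply, UpperHalfPlane.modular_T_smul] at this
    have hd : UpperHalfPlane.denom (ModularGroup.T : GL (Fin 2) ℝ) z = 1 := by
      rw [ModularGroup.denom_apply]
      simp [ModularGroup.T]
    rwa [hd, one_zpow, mul_one] at this
  have hexp : ∀ z : ℂ, exp (2 * Real.pi * I * (z + 1)) = exp (2 * Real.pi * I * z) := by
    intro z
    rw [mul_add, mul_one, exp_add, exp_two_pi_mul_I, mul_one]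
  have hper : Function.Periodic (f ∘ UpperHalfPlane.ofComplex) (1 : ℝ) := by
    intro z
    by_cases hz : 0 < z.im
    · have hz' : 0 < (z + (1 : ℝ)).im := by simpa using hz
      simp only [Function.comp_apply, hf, UpperHalfPlane.ofComplex_apply_of_im_pos hz,
        UpperHalfPlane.ofComplex_apply_of_im_pos hz']
      have h1 : (⟨z + (1 : ℝ), hz'⟩ : ℍ) = (1 : ℝ) +ᵥ (⟨z, hz⟩ : ℍ) := by
        ext
        simp [add_comm]
      rw [h1, hT]
      simp [hexp]
    · have hz' : (z + (1 : ℝ)).im ≤ 0 := by simpa using hz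
      simp only [Function.comp_apply,
        UpperHalfPlane.ofComplex_apply_eq_of_im_nonpos (not_lt.mp hz) hz']
  have hhol : MDifferentiable 𝓘(ℂ) 𝓘(ℂ) f := by
    have h1 := UpperHalfPlane.mdifferentiable_iff.mp hG.holo
    refine UpperHalfPlane.mdifferentiable_iff.mpr ?_
    have h2 : DifferentiableOn ℂ (fun z : ℂ => exp (2 * Real.pi * I * z) ^ N)
        UpperHalfPlane.upperHalfPlaneSet := by fun_prop
    refine (h2.mul h1).congr fun z hz => ?_
    simp [hf, UpperHalfPlane.ofComplex_apply_of_im_pos hz]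
  refine ⟨N, Function.Periodic.cuspFunction 1 (f ∘ UpperHalfPlane.ofComplex), fun q hq => ?_,
    fun z hz => ?_⟩
  · have hq' : ‖q‖ < 1 := by simpa using hq
    exact (UpperHalfPlane.differentiableAt_cuspFunction one_pos hper hhol hN
      hq').differentiableWithinAt
  · have h1 := Function.Periodic.eq_cuspFunction one_ne_zero hper z
    simp only [Function.Periodic.qParam, ofReal_one, div_one] at h1
    rw [h1]
    simp [hf, UpperHalfPlane.ofComplex_apply_of_im_pos hz]

theorem norm_exp_two_pi_I_mul (z : ℂ) :
    ‖exp (2 * Real.pi * I * z)‖ = Real.exp (-(2 * Real.pi) * z.im) := by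
  rw [norm_exp]
  congr 1
  simp

theorem exp_mem_ball {z : ℂ} (hz : 0 < z.im) :
    exp (2 * Real.pi * I * z) ∈ Metric.ball (0 : ℂ) 1 := by
  have hπ := Real.pi_pos
  rw [mem_ball_zero_iff, norm_exp_two_pi_I_mul, Real.exp_lt_one_iff]
  nlinarith [mul_pos hπ hz]

/-- A sequence of derivatives starting with `q ^ a * g(q)` consists of functions of this form. -/
theorem IsDerivSeq.exists_eq_pow_mul {H : ℕ → ℂ → ℂ} (hH : IsDerivSeq H) (a : ℕ) {g : ℂ → ℂ}
    (hg : DifferentiableOn ℂ g (Metric.ball 0 1))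
    (h0 : ∀ z : ℂ, 0 < z.im →
      H 0 z = exp (2 * Real.pi * I * z) ^ a * g (exp (2 * Real.pi * I * z))) (m : ℕ) :
    ∃ g' : ℂ → ℂ, DifferentiableOn ℂ g' (Metric.ball 0 1) ∧ ∀ z : ℂ, 0 < z.im →
      H m z = exp (2 * Real.pi * I * z) ^ a * g' (exp (2 * Real.pi * I * z)) := by
  induction m with
  | zero => exact ⟨g, hg, h0⟩
  | succ m ih =>
    obtain ⟨g', hg', hm⟩ := ih
    refine ⟨fun q => 2 * Real.pi * I * (a * g' q + q * deriv g' q), ?_, fun z hz => ?_⟩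
    · exact ((hg'.const_mul _).add (differentiableOn_id.mul
        (hg'.deriv Metric.isOpen_ball))).const_mul _
    · have he : HasDerivAt (fun z : ℂ => exp (2 * Real.pi * I * z))
          (exp (2 * Real.pi * I * z) * (2 * Real.pi * I * 1)) z :=
        ((hasDerivAt_id z).const_mul _).cexp
      have hg1 := (hg'.differentiableAt
        (Metric.isOpen_ball.mem_nhds (exp_mem_ball hz))).hasDerivAt
      have hd := (he.pow a).mul (hg1.comp z he)
      have heq := (hH m z hz).congr_of_eventuallyEq
        (f₁ := fun z => exp (2 * Real.pi * I * z) ^ a * g' (exp (2 * Real.pi * I * z))) (by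
        filter_upwards [isOpen_im_pos.mem_nhds hz] with w hw
        exact (hm w hw).symm)
      rw [heq.unique hd]
      rcases a with _ | a
      · simp
        ring
      · simp only [Pi.pow_apply, Function.comp_apply, Nat.add_sub_cancel]
        push_cast
        ring

theorem IsDerivSeq.exists_bound {H : ℕ → ℂ → ℂ} (hH : IsDerivSeq H) (a : ℕ) {g : ℂ → ℂ}
    (hg : DifferentiableOn ℂ g (Metric.ball 0 1))
    (h0 : ∀ z : ℂ, 0 < z.im →
      H 0 z = exp (2 * Real.pi * I * z) ^ a * g (exp (2 * Real.pi * I * z)))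
    {z₀ : ℂ} (hz₀ : 0 < z₀.im) (m : ℕ) :
    ∃ B : ℝ, ∀ t : ℝ, 0 ≤ t →
      ‖H m (z₀ + t * I)‖ ≤ B * Real.exp (-(2 * Real.pi * a) * t) := by
  have hπ := Real.pi_pos
  obtain ⟨g', hg', hm⟩ := hH.exists_eq_pow_mul a hg h0 m
  set ρ := Real.exp (-(2 * Real.pi) * z₀.im) with hρ
  have hρ1 : ρ < 1 := by
    rw [hρ, Real.exp_lt_one_iff]
    nlinarith [mul_pos hπ hz₀]
  obtain ⟨B, hB⟩ := (isCompact_closedBall (0 : ℂ) ρ).exists_bound_of_continuousOn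
    (hg'.continuousOn.mono (Metric.closedBall_subset_ball hρ1))
  refine ⟨B, fun t ht => ?_⟩
  have him : (z₀ + t * I).im = z₀.im + t := by simp
  have hpos : 0 < (z₀ + t * I).im := by rw [him]; linarith
  have hq := norm_exp_two_pi_I_mul (z₀ + t * I)
  rw [him] at hq
  rw [hm _ hpos, norm_mul, norm_pow, hq, mul_comm]
  have h1 : exp (2 * Real.pi * I * (z₀ + t * I)) ∈ Metric.closedBall (0 : ℂ) ρ := by
    rw [mem_closedBall_zero_iff, hq, hρ, Real.exp_le_exp]
    nlinarith [mul_nonneg hπ.le ht]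
  have h2 := hB _ h1
  refine mul_le_mul h2 ?_ (by positivity) ((norm_nonneg _).trans h2)
  rw [← Real.exp_nat_mul, Real.exp_le_exp]
  have : 0 ≤ (a : ℝ) * Real.pi * z₀.im := by positivity
  nlinarith

theorem IsDerivSeq.sub {H H' : ℕ → ℂ → ℂ} (hH : IsDerivSeq H) (hH' : IsDerivSeq H') :
    IsDerivSeq fun m z => H m z - H' m z := fun m z hz => (hH m z hz).sub (hH' m z hz)

theorem IsDerivSeq.sum {ι : Type*} (s : Finset ι) (c : ι → ℂ) {H : ι → ℕ → ℂ → ℂ}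
    (hH : ∀ i, IsDerivSeq (H i)) : IsDerivSeq fun m z => ∑ i ∈ s, c i * H i m z :=
  fun m z hz => HasDerivAt.fun_sum fun i _ => (hH i m z hz).const_mul (c i)

theorem pairing_sub_left (n : ℕ) (H H' : ℕ → ℂ → ℂ) (P : ℂ[X]) (z : ℂ) :
    pairing n (fun m z => H m z - H' m z) P z = pairing n H P z - pairing n H' P z := by
  simp only [pairing, ← Finset.sum_sub_distrib]
  exact Finset.sum_congr rfl fun j _ => by ring

theorem pairing_sum_left {ι : Type*} (s : Finset ι) (c : ι → ℂ) (n : ℕ) (H : ι → ℕ → ℂ → ℂ)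
    (P : ℂ[X]) (z : ℂ) :
    pairing n (fun m z => ∑ i ∈ s, c i * H i m z) P z = ∑ i ∈ s, c i * pairing n (H i) P z := by
  simp only [pairing, Finset.mul_sum, Finset.sum_mul]
  rw [Finset.sum_comm]
  exact Finset.sum_congr rfl fun i _ => Finset.sum_congr rfl fun j _ => by ring

/-- For a constant function only the undifferentiated term j = n survives. This is the source of the
correction by the constant Fourier coefficient. -/
theorem pairing_expSeq_zero (n : ℕ) (P : ℂ[X]) (z : ℂ) :
    pairing n (expSeq 0) P z = (-1) ^ n * (derivative^[n] P).eval z := by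
  rw [pairing, Finset.sum_range_succ, Finset.sum_eq_zero, zero_add]
  · simp [expSeq]
  · intro j hj
    have : n - j ≠ 0 := by
      have := Finset.mem_range.mp hj
      omega
    simp [expSeq, this]

/-- The regularized integral of the `(n + 1)`-st derivative of `G` times a polynomial of degree at
most `n`. -/
theorem IsWeaklyHolomorphic.exists_hasContinuation {w : ℤ} {G : ℍ → ℂ}
    (hG : IsWeaklyHolomorphic w G) : ∃ c₀ : ℂ, ∀ (n : ℕ) (P : ℂ[X]), P.natDegree ≤ n →
      ∀ z₀ : ℂ, 0 < z₀.im → ∀ K : ℕ,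
        HasContinuation K (fun z => iterDeriv G (n + 1) z * P.eval z) z₀
          (-pairing n (iterDeriv G) P z₀ + c₀ * ((-1) ^ n * (derivative^[n] P).eval z₀)) := by
  obtain ⟨N, g, hg, hGg⟩ := hG.exists_qExpansion
  refine ⟨taylorQuotient g N 0, fun n P hP z₀ hz₀ K => ?_⟩
  -- With this many terms split off, the remainder divided by q^N still contains q^(K+1), the decay
  -- required for the half-plane of index K.
  set M := N + K + 1 with hM
  let c : ℕ → ℂ := fun i => taylorQuotient g i 0
  let E : ℕ → ℕ → ℂ → ℂ := fun i => expSeq (2 * Real.pi * I * ((i : ℤ) - N : ℤ))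
  let S : ℕ → ℂ → ℂ := fun m z => ∑ i ∈ Finset.range M, c i * E i m z
  have hH := isDerivSeq_iterDeriv hG.holo
  have hS : IsDerivSeq S := IsDerivSeq.sum _ c fun i => isDerivSeq_expSeq _
  have hT0 : ∀ z : ℂ, 0 < z.im → iterDeriv G 0 z - S 0 z =
      exp (2 * Real.pi * I * z) ^ (K + 1) * taylorQuotient g M (exp (2 * Real.pi * I * z)) := by
    intro z hz
    have hq0 : exp (2 * Real.pi * I * z) ^ N ≠ 0 := pow_ne_zero _ (exp_ne_zero _)
    refine mul_left_cancel₀ hq0 ?_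
    have h1 : exp (2 * Real.pi * I * z) ^ N * iterDeriv G 0 z = g (exp (2 * Real.pi * I * z)) := by
      rw [← hGg z hz]
      simp [iterDeriv]
    have h2 : exp (2 * Real.pi * I * z) ^ N * S 0 z =
        ∑ i ∈ Finset.range M, c i * exp (2 * Real.pi * I * z) ^ i := by
      simp only [S, E, expSeq, pow_zero, one_mul, Finset.mul_sum]
      refine Finset.sum_congr rfl fun i _ => ?_
      rw [← exp_nat_mul, ← exp_nat_mul, mul_left_comm, ← exp_add]
      congr 2
      push_cast
      ring
    rw [mul_sub, h1, h2, eq_sum_add_taylorQuotient g M, add_sub_cancel_left, hM]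
    ring
  have htail := (hH.sub hS).hasContinuation_of_exp_decay K hP hz₀ (fun m => by
    have := (hH.sub hS).exists_bound (K + 1) (differentiableOn_taylorQuotient hg M) hT0 hz₀ m
    simpa using this)
  have hterm : ∀ i ∈ Finset.range M, HasContinuation K
      (fun z => c i * (E i (n + 1) z * P.eval z)) z₀
      (c i * (-pairing n (E i) P z₀ +
        if i = N then (-1) ^ n * (derivative^[n] P).eval z₀ else 0)) := by
    intro i _
    refine HasContinuation.const_mul _ ?_
    -- The index N is the constant term: its integrand is zero, and the added summand cancels its
    -- pairing.
    by_cases hi : i = N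
    · subst hi
      have hE : E i = expSeq 0 := by simp [E]
      rw [if_pos rfl, hE, pairing_expSeq_zero, neg_add_cancel]
      exact HasContinuation.zero.congr hz₀ fun z _ => by simp [expSeq]
    · rw [if_neg hi, add_zero]
      exact hasContinuation_expSeq K hP hz₀ (by omega)
  have hall := (HasContinuation.sum _ hterm).add htail
  have hval : ∑ i ∈ Finset.range M, c i * (-pairing n (E i) P z₀ +
        if i = N then (-1) ^ n * (derivative^[n] P).eval z₀ else 0) +
      -pairing n (fun m z => iterDeriv G m z - S m z) P z₀ =
      -pairing n (iterDeriv G) P z₀ +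
        taylorQuotient g N 0 * ((-1) ^ n * (derivative^[n] P).eval z₀) := by
    have hNM : N ∈ Finset.range M := Finset.mem_range.mpr (by omega)
    have hpS : pairing n S P z₀ = ∑ i ∈ Finset.range M, c i * pairing n (E i) P z₀ :=
      pairing_sum_left _ c n E P z₀
    rw [pairing_sub_left, hpS]
    simp only [mul_add, Finset.sum_add_distrib, mul_ite, mul_zero, mul_neg, Finset.sum_neg_distrib,
      Finset.sum_ite_eq', if_pos hNM]
    ring
  rw [hval] at hall
  refine hall.congr hz₀ fun z _ => ?_
  simp only [S, Finset.sum_mul, sub_mul]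
  rw [← sub_eq_zero]
  simp only [mul_assoc]
  ring

end QExpansion

/-! ### Quadratic forms, their automorphs and their cusps -/

section Forms

open Polynomial Derivative

/-- The polynomial `Q(X, 1)`. -/
def BinaryForm.poly (Q : BinaryForm) : ℂ[X] := C (Q.a : ℂ) * X ^ 2 + C (Q.b : ℂ) * X + C (Q.c : ℂ)

theorem BinaryForm.eval_poly (Q : BinaryForm) (z : ℂ) : Q.poly.eval z = Q.eval z := by
  simp [poly, BinaryForm.eval]

theorem BinaryForm.natDegree_poly_pow_le (Q : BinaryForm) (m : ℕ) :
    (Q.poly ^ m).natDegree ≤ m + m := by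
  refine natDegree_pow_le.trans ?_
  have := Nat.mul_le_mul_left m (natDegree_quadratic_le (a := (Q.a : ℂ)) (b := Q.b) (c := Q.c))
  unfold poly
  omega

/-- Only the coefficient of X^(2m) survives, and in Q(X,1)^m it is a^m. -/
theorem BinaryForm.iterate_derivative_poly_pow (Q : BinaryForm) (m : ℕ) (z : ℂ) :
    (derivative^[m + m] (Q.poly ^ m)).eval z = (m + m).factorial * (Q.a : ℂ) ^ m := by
  have hdeg : (derivative^[m + m] (Q.poly ^ m)).natDegree ≤ 0 := by
    have h1 := natDegree_iterate_derivative (Q.poly ^ m) (m + m)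
    have h2 := Q.natDegree_poly_pow_le m
    omega
  rw [eq_C_of_natDegree_le_zero hdeg, eval_C, coeff_iterate_derivative, zero_add,
    Nat.descFactorial_self, nsmul_eq_mul]
  congr 1
  have hq : Q.poly.natDegree ≤ 2 := natDegree_quadratic_le
  have h3 := coeff_pow_of_natDegree_le (m := m) hq
  rw [← mul_two, h3]
  simp only [poly, coeff_add, coeff_C_mul, coeff_X_pow, coeff_X, coeff_C]
  norm_num

/-- Splitting over ℂ brings Q into the product form required by `IsCovariant.pairing_mul_pow`; for a
= 0 one factor is the constant 1. -/
theorem BinaryForm.exists_factorization (Q : BinaryForm) : ∃ α₁ β₁ α₂ β₂ : ℂ,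
    (Q.a : ℂ) = α₁ * α₂ ∧ (Q.b : ℂ) = α₁ * β₂ + α₂ * β₁ ∧ (Q.c : ℂ) = β₁ * β₂ := by
  by_cases ha : (Q.a : ℂ) = 0
  · exact ⟨0, 1, Q.b, Q.c, by simp [ha], by simp, by simp⟩
  · obtain ⟨s, hs⟩ := IsAlgClosed.exists_pow_nat_eq
      ((Q.b : ℂ) ^ 2 - 4 * Q.a * Q.c) (n := 2) two_pos
    refine ⟨Q.a, (Q.b + s) / 2, 1, (Q.b - s) / (2 * Q.a), by simp, ?_, ?_⟩
    · field_simp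
      ring
    · field_simp
      linear_combination hs

theorem BinaryForm.poly_eq_mul (Q : BinaryForm) {α₁ β₁ α₂ β₂ : ℂ} (ha : (Q.a : ℂ) = α₁ * α₂)
    (hb : (Q.b : ℂ) = α₁ * β₂ + α₂ * β₁) (hc : (Q.c : ℂ) = β₁ * β₂) :
    Q.poly = (C α₁ * X + C β₁) * (C α₂ * X + C β₂) := by
  rw [poly, ha, hb, hc]
  simp only [map_mul, map_add]
  ring

/-- The form `Q ∘ σ`. -/
def BinaryForm.comp (Q : BinaryForm) (σ : SL(2, ℤ)) : BinaryForm where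
  a := Q.a * σ 0 0 ^ 2 + Q.b * σ 0 0 * σ 1 0 + Q.c * σ 1 0 ^ 2
  b := 2 * Q.a * σ 0 0 * σ 0 1 + Q.b * (σ 0 0 * σ 1 1 + σ 0 1 * σ 1 0) + 2 * Q.c * σ 1 0 * σ 1 1
  c := Q.a * σ 0 1 ^ 2 + Q.b * σ 0 1 * σ 1 1 + Q.c * σ 1 1 ^ 2

/-- The Möbius action of `SL(2, ℤ)`, as a function on `ℂ`. -/
def moebius (σ : SL(2, ℤ)) (z : ℂ) : ℂ := ((σ • UpperHalfPlane.ofComplex z : ℍ) : ℂ)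

theorem denom_ne_zero (σ : SL(2, ℤ)) {z : ℂ} (hz : 0 < z.im) :
    ((σ 1 0 : ℤ) : ℂ) * z + (σ 1 1 : ℤ) ≠ 0 := by
  have := UpperHalfPlane.denom_ne_zero (σ : GL (Fin 2) ℝ) ⟨z, hz⟩
  rwa [ModularGroup.denom_apply] at this

theorem coe_smul_eq (σ : SL(2, ℤ)) (z : ℍ) : ((σ • z : ℍ) : ℂ) =
    ((σ 0 0 : ℤ) * z + (σ 0 1 : ℤ)) / ((σ 1 0 : ℤ) * z + (σ 1 1 : ℤ)) := by
  rw [UpperHalfPlane.coe_specialLinearGroup_apply]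
  simp

theorem moebius_eq (σ : SL(2, ℤ)) {z : ℂ} (hz : 0 < z.im) : moebius σ z =
    ((σ 0 0 : ℤ) * z + (σ 0 1 : ℤ)) / ((σ 1 0 : ℤ) * z + (σ 1 1 : ℤ)) := by
  rw [moebius, coe_smul_eq, UpperHalfPlane.ofComplex_apply_of_im_pos hz]

theorem det_eq_one (σ : SL(2, ℤ)) :
    ((σ 0 0 : ℤ) : ℂ) * (σ 1 1 : ℤ) - (σ 0 1 : ℤ) * (σ 1 0 : ℤ) = 1 := by
  have := σ.det_coe
  rw [Matrix.det_fin_two] at this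
  exact_mod_cast this

theorem BinaryForm.eval_comp (Q : BinaryForm) (σ : SL(2, ℤ)) {z : ℂ} (hz : 0 < z.im) :
    (Q.comp σ).eval z = Q.eval (moebius σ z) * ((σ 1 0 : ℤ) * z + (σ 1 1 : ℤ)) ^ 2 := by
  have := denom_ne_zero σ hz
  rw [moebius_eq σ hz, BinaryForm.eval, BinaryForm.eval]
  simp only [BinaryForm.comp]
  push_cast
  field_simp
  ring

variable {m : ℕ} {G : ℍ → ℂ}

theorem IsWeaklyHolomorphic.isCovariant (hG : IsWeaklyHolomorphic (-((m + m : ℕ) : ℤ)) G)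
    (σ : SL(2, ℤ)) :
    IsCovariant (m + m) (iterDeriv G) (σ 0 0 : ℤ) (σ 0 1 : ℤ) (σ 1 0 : ℤ) (σ 1 1 : ℤ)
      (moebius σ) where
  derivSeq := isDerivSeq_iterDeriv hG.holo
  det := det_eq_one σ
  denom_ne _ hz := denom_ne_zero σ hz
  im_pos z _ := (σ • UpperHalfPlane.ofComplex z : ℍ).im_pos
  map_eq _ hz := moebius_eq σ hz
  zero_eq z hz := by
    have := congrFun (hG.slash_eq σ) (UpperHalfPlane.ofComplex z)
    rw [ModularForm.SL_slash_apply, neg_neg, zpow_natCast, ModularGroup.denom_apply,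
      UpperHalfPlane.ofComplex_apply_of_im_pos hz] at this
    simp only [iterDeriv, pow_zero, one_mul, Function.iterate_zero, id, moebius,
      UpperHalfPlane.ofComplex_apply, UpperHalfPlane.ofComplex_apply_of_im_pos hz]
    rw [← this, mul_comm]

/-- Covariance of the primitive of the cycle integrand. -/
theorem IsWeaklyHolomorphic.pairing_moebius (hG : IsWeaklyHolomorphic (-((m + m : ℕ) : ℤ)) G)
    (Q : BinaryForm) (σ : SL(2, ℤ)) {z : ℂ} (hz : 0 < z.im) :
    pairing (m + m) (iterDeriv G) (Q.poly ^ m) (moebius σ z) =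
      pairing (m + m) (iterDeriv G) ((Q.comp σ).poly ^ m) z := by
  obtain ⟨α₁, β₁, α₂, β₂, ha, hb, hc⟩ := Q.exists_factorization
  rw [Q.poly_eq_mul ha hb hc, (hG.isCovariant σ).pairing_mul_pow _ _ _ _ hz,
    (Q.comp σ).poly_eq_mul]
  all_goals
    simp only [BinaryForm.comp]
    push_cast
    rw [ha, hb, hc]
    ring

theorem cycleIntegrand_ofComplex (G : ℍ → ℂ) (Q : BinaryForm) (m : ℕ) {z : ℂ} (hz : 0 < z.im) :
    cycleIntegrand ((m + 1 : ℕ) : ℤ) (normalizedDerivOfComplex^[m + m + 1] G) Q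
        (UpperHalfPlane.ofComplex z) =
      ((2 * Real.pi * I) ^ (m + m + 1))⁻¹ *
        (iterDeriv G (m + m + 1) z * (Q.poly ^ m).eval z) := by
  have h3 : (2 * Real.pi * I : ℂ) ≠ 0 := two_pi_I_ne_zero
  rw [cycleIntegrand, iterDeriv, eval_pow, BinaryForm.eval_poly,
    show ((m + 1 : ℕ) : ℤ) - 1 = (m : ℤ) by push_cast; ring, zpow_natCast,
    UpperHalfPlane.ofComplex_apply_of_im_pos hz]
  field_simp

/-! ### Forms of non-square discriminant -/

theorem BinaryForm.a_ne_zero {Q : BinaryForm} (h : ¬ IsSquare Q.disc) : Q.a ≠ 0 := by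
  intro h0
  exact h ⟨Q.b, by simp [BinaryForm.disc, h0, sq]⟩

/-- With determinant 1, these relations suffice for invariance of Q; t and the halving drop out. -/
theorem automorph_entries {Q : BinaryForm} (hQ : 0 < Q.disc) (h : ¬ IsSquare Q.disc) :
    ∃ u : ℤ, automorph Q 0 1 = Q.c * u ∧ automorph Q 1 0 = -(Q.a * u) ∧
      automorph Q 0 0 - automorph Q 1 1 = Q.b * u := by
  have hs := (exists_isSmallestPell Q.disc hQ h).choose_spec
  set p := (exists_isSmallestPell Q.disc hQ h).choose with hp
  have hA : automorph Q = ⟨_, det_automorph Q hs.2.2.1⟩ := dif_pos ⟨hQ, h⟩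
  refine ⟨p.2, ?_, ?_, ?_⟩
  · rw [hA]
    rfl
  · rw [hA]
    rfl
  · have hpar : Even (p.1 + Q.b * p.2) := by
      have h1 : (p.1 + Q.b * p.2) * (p.1 - Q.b * p.2) = 2 * (2 - 2 * Q.a * Q.c * p.2 ^ 2) := by
        have := hs.2.2.1
        simp only [BinaryForm.disc] at this
        linear_combination this
      have h2 : Even ((p.1 + Q.b * p.2) * (p.1 - Q.b * p.2)) := by
        rw [h1]; exact even_two_mul _
      rcases Int.even_mul.mp h2 with h3 | h3
      · exact h3
      · have : p.1 + Q.b * p.2 = (p.1 - Q.b * p.2) + 2 * (Q.b * p.2) := by ring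
        rw [this]
        exact h3.add (even_two_mul _)
    obtain ⟨r, hr⟩ := hpar
    have e1 : (p.1 + Q.b * p.2) / 2 = r := by omega
    have e2 : (p.1 - Q.b * p.2) / 2 = r - Q.b * p.2 := by omega
    rw [hA]
    show (p.1 + Q.b * p.2) / 2 - (p.1 - Q.b * p.2) / 2 = Q.b * p.2
    rw [e1, e2]
    ring

theorem comp_automorph {Q : BinaryForm} (hQ : 0 < Q.disc) (h : ¬ IsSquare Q.disc) :
    Q.comp (automorph Q) = Q := by
  obtain ⟨u, h01, h10, hd⟩ := automorph_entries hQ h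
  have hdet := (automorph Q).det_coe
  rw [Matrix.det_fin_two] at hdet
  rw [h01, h10] at hdet
  have h00 : automorph Q 0 0 = automorph Q 1 1 + Q.b * u := by linarith
  rw [h00] at hdet
  ext
  all_goals
    simp only [BinaryForm.comp, h01, h10, h00]
  · linear_combination Q.a * hdet
  · linear_combination Q.b * hdet
  · linear_combination Q.c * hdet

theorem smul_mem_geodesic (Q : BinaryForm) (σ : SL(2, ℤ)) {z : ℍ} (hz : z ∈ geodesic (Q.comp σ)) :
    σ • z ∈ geodesic Q := by
  have hj := denom_ne_zero σ z.im_pos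
  have hz' : ((Q.comp σ).a : ℝ) * normSq (z : ℂ) + (Q.comp σ).b * (z : ℂ).re + (Q.comp σ).c = 0 :=
    hz
  show (Q.a : ℝ) * normSq ((σ • z : ℍ) : ℂ) + Q.b * ((σ • z : ℍ) : ℂ).re + Q.c = 0
  have hn : normSq (((σ 1 0 : ℤ) : ℂ) * z + (σ 1 1 : ℤ)) ≠ 0 := by simpa using hj
  rw [coe_smul_eq, normSq_div, div_re]
  simp only [BinaryForm.comp] at hz'
  push_cast at hz'
  have hfrac : ∀ a b c n x y N : ℝ, N ≠ 0 → a * n + b * (x + y) + c * N = 0 →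
      a * (n / N) + b * (x / N + y / N) + c = 0 := by
    intro a b c n x y N hN h
    field_simp
    linear_combination h
  refine hfrac _ _ _ _ _ _ _ hn ?_
  simp only [normSq_apply, add_re, add_im, mul_re, mul_im, intCast_re, intCast_im, zero_mul,
    sub_zero, add_zero] at hz' ⊢
  linear_combination hz'

theorem geodesic_polar {Q : BinaryForm} (ha : Q.a ≠ 0) {z : ℍ} (hz : z ∈ geodesic Q) :
    circleMap (center Q) (radius Q) (angle Q z) = z := by
  have hz' : (Q.a : ℝ) * normSq (z : ℂ) + Q.b * (z : ℂ).re + Q.c = 0 := hz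
  have ha' : (Q.a : ℝ) ≠ 0 := by exact_mod_cast ha
  have hnorm : ‖(z : ℂ) - center Q‖ = radius Q := by
    have h1 : normSq ((z : ℂ) - center Q) = (Q.disc : ℝ) / (2 * Q.a) ^ 2 := by
      rw [normSq_apply] at hz' ⊢
      simp only [sub_re, sub_im, ofReal_re, ofReal_im, sub_zero, center, BinaryForm.disc]
      push_cast
      field_simp
      linear_combination 4 * Q.a * hz'
    rw [norm_def, h1, radius, Real.sqrt_div' _ (by positivity), Real.sqrt_sq_eq_abs, abs_mul,
      abs_of_pos (two_pos : (0 : ℝ) < 2)]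
  have := norm_mul_exp_arg_mul_I ((z : ℂ) - center Q)
  rw [hnorm] at this
  rw [circleMap, angle, this]
  ring

theorem angle_mem_Ioo (Q : BinaryForm) (z : ℍ) : angle Q z ∈ Set.Ioo 0 Real.pi := by
  have him : 0 < ((z : ℂ) - center Q).im := by simpa using z.im_pos
  refine ⟨lt_of_le_of_ne (arg_nonneg_iff.mpr him.le) fun h => ?_, arg_lt_pi_iff.mpr (Or.inr him.ne')⟩
  have := (arg_eq_zero_iff.mp h.symm).2
  exact him.ne' this

theorem radius_pos {Q : BinaryForm} (hQ : 0 < Q.disc) (ha : Q.a ≠ 0) : 0 < radius Q := by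
  have h1 : (0 : ℝ) < Q.disc := by exact_mod_cast hQ
  have h2 : (Q.a : ℝ) ≠ 0 := by exact_mod_cast ha
  unfold radius
  positivity

/-- Needed for uniqueness: the arc condition quantifies over points of the geodesic and would
otherwise be vacuous. The witness is the top of the semicircle. -/
theorem geodesic_nonempty {Q : BinaryForm} (hQ : 0 < Q.disc) (ha : Q.a ≠ 0) :
    (geodesic Q).Nonempty := by
  have hr := radius_pos hQ ha
  have ha' : (Q.a : ℝ) ≠ 0 := by exact_mod_cast ha
  refine ⟨⟨center Q + radius Q * I, by simpa using hr⟩, ?_⟩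
  show (Q.a : ℝ) * normSq (center Q + radius Q * I) + Q.b * (center Q + radius Q * I : ℂ).re + Q.c = 0
  have h2 : radius Q ^ 2 = (Q.disc : ℝ) / (2 * Q.a) ^ 2 := by
    rw [radius, div_pow, Real.sq_sqrt (by exact_mod_cast hQ.le), mul_pow, sq_abs, mul_pow]
  have h3 : normSq (center Q + radius Q * I) = center Q ^ 2 + radius Q ^ 2 := by
    rw [normSq_add_mul_I]
  rw [h3, h2]
  simp only [add_re, ofReal_re, re_ofReal_mul, I_re, mul_zero, add_zero, center, BinaryForm.disc]
  push_cast
  field_simp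
  ring

/-- Both angles lie in (0, π), so the arc stays in ℍ and the primitive applies; its end values agree
because the automorph fixes Q. -/
theorem IsWeaklyHolomorphic.hasArcIntegral (hG : IsWeaklyHolomorphic (-((m + m : ℕ) : ℤ)) G)
    {Q : BinaryForm} (hQ : 0 < Q.disc) (hsq : ¬ IsSquare Q.disc) {z : ℍ} (hz : z ∈ geodesic Q) :
    HasArcIntegral (cycleIntegrand ((m + 1 : ℕ) : ℤ) (normalizedDerivOfComplex^[m + m + 1] G) Q) Q
      z (automorph Q • z) 0 := by
  have ha := BinaryForm.a_ne_zero hsq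
  have hcomp := comp_automorph hQ hsq
  have hw : automorph Q • z ∈ geodesic Q := smul_mem_geodesic Q (automorph Q) (by rwa [hcomp])
  set f := arcIntegrand
    (cycleIntegrand ((m + 1 : ℕ) : ℤ) (normalizedDerivOfComplex^[m + m + 1] G) Q) Q with hf
  have hH := isDerivSeq_iterDeriv hG.holo
  set κ : ℂ := ((2 * Real.pi * I) ^ (m + m + 1))⁻¹ with hκ
  have him : ∀ θ ∈ Set.uIcc (angle Q z) (angle Q (automorph Q • z)),
      0 < (circleMap (center Q) (radius Q) θ).im := by
    intro θ hθ
    have h1 := (Set.ordConnected_Ioo.uIcc_subset (angle_mem_Ioo Q z)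
      (angle_mem_Ioo Q (automorph Q • z))) hθ
    have h2 := Real.sin_pos_of_pos_of_lt_pi h1.1 h1.2
    have h3 : (circleMap (center Q) (radius Q) θ).im = radius Q * Real.sin θ := by
      simp [circleMap, exp_ofReal_mul_I_im]
    rw [h3]
    exact mul_pos (radius_pos hQ ha) h2
  have hfe : ∀ θ ∈ Set.uIcc (angle Q z) (angle Q (automorph Q • z)),
      f θ = κ * (iterDeriv G (m + m + 1) (circleMap (center Q) (radius Q) θ) *
        (Q.poly ^ m).eval (circleMap (center Q) (radius Q) θ)) *
        deriv (circleMap (center Q) (radius Q)) θ := by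
    intro θ hθ
    rw [hf, arcIntegrand, cycleIntegrand_ofComplex G Q m (him θ hθ)]
  have hcont : ContinuousOn f (Set.uIcc (angle Q z) (angle Q (automorph Q • z))) := by
    refine ContinuousOn.congr ?_ hfe
    refine ContinuousOn.mul (continuousOn_const.mul (ContinuousOn.mul ?_ ?_)) ?_
    · intro θ hθ
      exact ((hH (m + m + 1) _ (him θ hθ)).continuousAt.comp
        (continuous_circleMap _ _).continuousAt).continuousWithinAt
    · exact ((Q.poly ^ m).continuous.comp (continuous_circleMap _ _)).continuousOn
    · have : deriv (circleMap (center Q) (radius Q)) =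
          fun θ => circleMap 0 (radius Q) θ * I := by
        ext θ
        exact deriv_circleMap _ _ _
      rw [this]
      exact ((continuous_circleMap _ _).mul continuous_const).continuousOn
  refine ⟨hcont.intervalIntegrable, ?_⟩
  have hd : ∀ θ ∈ Set.uIcc (angle Q z) (angle Q (automorph Q • z)),
      HasDerivAt (fun θ => κ * pairing (m + m) (iterDeriv G) (Q.poly ^ m)
        (circleMap (center Q) (radius Q) θ)) (f θ) θ := by
    intro θ hθ
    rw [hfe θ hθ, mul_assoc]
    refine HasDerivAt.const_mul κ ?_
    have h1 := hasDerivAt_pairing hH (Q.natDegree_poly_pow_le m) (him θ hθ)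
    have h2 := (differentiable_circleMap (center Q : ℂ) (radius Q) θ).hasDerivAt
    exact h1.comp θ h2
  rw [intervalIntegral.integral_eq_sub_of_hasDerivAt hd hcont.intervalIntegrable,
    geodesic_polar ha hz, geodesic_polar ha hw]
  have hinv := hG.pairing_moebius Q (automorph Q) z.im_pos
  rw [hcomp, moebius, UpperHalfPlane.ofComplex_apply] at hinv
  rw [hinv, sub_self]

/-! ### Forms of square discriminant -/

/-- The leading coefficient of Q∘σ is Q evaluated at the first column of σ, which represents σ∞ = x.
-/
theorem cusp_coeff_eq_zero (Q : BinaryForm) (σ : SL(2, ℤ)) {x : ℚ} (hσ : IsScaling σ (x : OnePoint ℚ))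
    (hx : Q.a * x ^ 2 + Q.b * x + Q.c = 0) : (Q.comp σ).a = 0 := by
  unfold IsScaling at hσ
  rw [OnePoint.smul_infty_eq_ite] at hσ
  split_ifs at hσ with h0
  · simp at hσ
  · simp at hσ h0
    have h0' : ((σ 1 0 : ℤ) : ℚ) ≠ 0 := by exact_mod_cast h0
    rw [← hσ] at hx
    field_simp at hx
    have : ((Q.comp σ).a : ℚ) = 0 := by
      simp only [BinaryForm.comp]
      push_cast
      linear_combination hx
    exact_mod_cast this

theorem cast_sqrt_disc_sq {Q : BinaryForm} (hsq : IsSquare Q.disc) :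
    ((Int.sqrt Q.disc : ℤ) : ℚ) ^ 2 = Q.b ^ 2 - 4 * Q.a * Q.c := by
  obtain ⟨s, hs⟩ := hsq
  have hsqrt : (Int.sqrt Q.disc) ^ 2 = Q.disc := by
    rw [hs, Int.sqrt_eq, sq, Int.natAbs_mul_self']
  rw [← Int.cast_pow, hsqrt, BinaryForm.disc]
  push_cast
  ring

theorem startCusp_coeff {Q : BinaryForm} (hQ : 0 < Q.disc) (hsq : IsSquare Q.disc) {σ : SL(2, ℤ)}
    (hσ : IsScaling σ (startCusp Q)) : (Q.comp σ).a = 0 := by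
  have hsqrt := cast_sqrt_disc_sq hsq
  unfold startCusp at hσ
  split_ifs at hσ with ha
  · refine cusp_coeff_eq_zero Q σ hσ ?_
    have hb : (Q.b : ℚ) ≠ 0 := by
      intro hb
      have hb' : Q.b = 0 := by exact_mod_cast hb
      simp [BinaryForm.disc, ha, hb'] at hQ
    rw [ha]
    field_simp
    push_cast
    ring
  · refine cusp_coeff_eq_zero Q σ hσ ?_
    have ha' : (Q.a : ℚ) ≠ 0 := by exact_mod_cast ha
    field_simp
    linear_combination hsqrt

theorem endCusp_coeff {Q : BinaryForm} (hsq : IsSquare Q.disc) {σ : SL(2, ℤ)}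
    (hσ : IsScaling σ (endCusp Q)) : (Q.comp σ).a = 0 := by
  have hsqrt := cast_sqrt_disc_sq hsq
  unfold endCusp at hσ
  split_ifs at hσ with ha
  · unfold IsScaling at hσ
    rw [OnePoint.smul_infty_eq_self_iff] at hσ
    have h10 : σ 1 0 = 0 := by simpa using hσ
    simp [BinaryForm.comp, ha, h10]
  · refine cusp_coeff_eq_zero Q σ hσ ?_
    have ha' : (Q.a : ℚ) ≠ 0 := by exact_mod_cast ha
    field_simp
    linear_combination hsqrt

/-- The order of quantifiers is the point: v depends on the base point but not on σ, so it is the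
same for both cusps. The factor 0^m is 1 when m = 0, where the constant term persists but is common
to both. -/
theorem IsWeaklyHolomorphic.exists_slash_hasContinuation
    (hG : IsWeaklyHolomorphic (-((m + m : ℕ) : ℤ)) G) (Q : BinaryForm) (z₀ : ℍ) :
    ∃ v : ℂ, ∀ σ : SL(2, ℤ), (Q.comp σ).a = 0 → ∀ K : ℕ, HasContinuation K
      (((cycleIntegrand ((m + 1 : ℕ) : ℤ) (normalizedDerivOfComplex^[m + m + 1] G) Q) ∣[(2 : ℤ)] σ) ∘
        UpperHalfPlane.ofComplex) ((σ⁻¹ • z₀ : ℍ) : ℂ) v := by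
  obtain ⟨c₀, hc₀⟩ := hG.exists_hasContinuation
  set κ : ℂ := ((2 * Real.pi * I) ^ (m + m + 1))⁻¹ with hκ
  refine ⟨κ * (-pairing (m + m) (iterDeriv G) (Q.poly ^ m) z₀ +
    c₀ * ((-1) ^ (m + m) * ((m + m).factorial * 0 ^ m))), fun σ hσ K => ?_⟩
  have hz := (σ⁻¹ • z₀ : ℍ).im_pos
  have h1 := (hc₀ (m + m) _ ((Q.comp σ).natDegree_poly_pow_le m) _ hz K).const_mul κ
  have hm : moebius σ ((σ⁻¹ • z₀ : ℍ) : ℂ) = z₀ := by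
    rw [moebius, UpperHalfPlane.ofComplex_apply, smul_inv_smul]
  rw [BinaryForm.iterate_derivative_poly_pow, hσ, ← hG.pairing_moebius Q σ hz, hm,
    Int.cast_zero] at h1
  -- Bol's factor J^(2m+2) cancels J^(-2) from the slash action and the J^(-2m) relating Q(σw)^m to
  -- (Q∘σ)(w)^m.
  refine h1.congr hz fun w hw => ?_
  have hj := denom_ne_zero σ hw
  have hb := (hG.isCovariant σ).bol hw
  have hc := cycleIntegrand_ofComplex G Q m ((hG.isCovariant σ).im_pos w hw)
  have he : UpperHalfPlane.ofComplex (moebius σ w) = σ • UpperHalfPlane.ofComplex w := by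
    rw [moebius, UpperHalfPlane.ofComplex_apply]
  rw [he] at hc
  have hd : UpperHalfPlane.denom (σ : GL (Fin 2) ℝ) (UpperHalfPlane.ofComplex w) =
      (σ 1 0 : ℤ) * w + (σ 1 1 : ℤ) := by
    rw [ModularGroup.denom_apply, UpperHalfPlane.ofComplex_apply_of_im_pos hw]
  rw [Function.comp_apply, ModularForm.SL_slash_apply, hc, hd, hb, eval_pow, eval_pow,
    BinaryForm.eval_poly, BinaryForm.eval_poly, Q.eval_comp σ hw, ← hκ]
  set J : ℂ := (σ 1 0 : ℤ) * w + (σ 1 1 : ℤ)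
  rw [zpow_neg, mul_pow, ← pow_mul]
  rw [show m + m + 2 = 2 * m + 2 by ring, pow_add]
  field_simp

theorem exists_isScaling (𝔞 : OnePoint ℚ) : ∃ σ : SL(2, ℤ), IsScaling σ 𝔞 :=
  OnePoint.exists_mem_SL2 ℤ 𝔞

theorem IsWeaklyHolomorphic.hasCycleIntegral_iff
    (hG : IsWeaklyHolomorphic (-((m + m : ℕ) : ℤ)) G) {Q : BinaryForm} (hQ : 0 < Q.disc) (v : ℂ) :
    HasCycleIntegral ((m + 1 : ℕ) : ℤ) (normalizedDerivOfComplex^[m + m + 1] G) Q v ↔ v = 0 := by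
  by_cases hsq : IsSquare Q.disc
  · have hreg : ∀ (z₀ : ℍ), ∃ v₀ : ℂ, ∀ σ : SL(2, ℤ), (Q.comp σ).a = 0 →
        ∀ K, HasContinuation K (((cycleIntegrand ((m + 1 : ℕ) : ℤ)
          (normalizedDerivOfComplex^[m + m + 1] G) Q) ∣[(2 : ℤ)] σ) ∘
          UpperHalfPlane.ofComplex) ((σ⁻¹ • z₀ : ℍ) : ℂ) v₀ :=
      fun z₀ => hG.exists_slash_hasContinuation Q z₀
    constructor
    · rintro ⟨_, h⟩
      obtain ⟨σ, hσ⟩ := exists_isScaling (startCusp Q)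
      obtain ⟨τ, hτ⟩ := exists_isScaling (endCusp Q)
      obtain ⟨v₁, v₂, h₁, h₂, rfl⟩ := h hsq UpperHalfPlane.I σ τ hσ hτ
      obtain ⟨v₀, hv₀⟩ := hreg UpperHalfPlane.I
      rw [h₁.eq_of_hasContinuation (hv₀ σ (startCusp_coeff hQ hsq hσ)),
        h₂.eq_of_hasContinuation (hv₀ τ (endCusp_coeff hsq hτ)), sub_self]
    · rintro rfl
      refine ⟨fun h => absurd hsq h, fun _ z₀ σ τ hσ hτ => ?_⟩
      obtain ⟨v₀, hv₀⟩ := hreg z₀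
      exact ⟨v₀, v₀, (hv₀ σ (startCusp_coeff hQ hsq hσ) 0).hasRegIntegral,
        (hv₀ τ (endCusp_coeff hsq hτ) 0).hasRegIntegral, (sub_self _).symm⟩
  · constructor
    · rintro ⟨h, _⟩
      obtain ⟨z, hz⟩ := geodesic_nonempty hQ (BinaryForm.a_ne_zero hsq)
      rw [← (h hsq z hz).2, (hG.hasArcIntegral hQ hsq hz).2]
    · rintro rfl
      exact ⟨fun _ z hz => hG.hasArcIntegral hQ hsq hz, fun h => absurd h hsq⟩

end Forms

end CycleIntegral

end

theorem corollary1p2 (k : ℕ) (hk : 1 ≤ k) (G : ℍ → ℂ)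
    (hG : CycleIntegral.IsWeaklyHolomorphic (2 - 2 * (k : ℤ)) G)
    (Q : CycleIntegral.BinaryForm) (hQ : 0 < Q.disc) :
    ∀ v : ℂ, CycleIntegral.HasCycleIntegral k
      (Derivative.normalizedDerivOfComplex^[2 * k - 1] G) Q v ↔ v = 0 := by
  obtain ⟨m, rfl⟩ : ∃ m, k = m + 1 := ⟨k - 1, by omega⟩
  have hw : (2 - 2 * ((m + 1 : ℕ) : ℤ)) = -((m + m : ℕ) : ℤ) := by push_cast; ring
  rw [hw] at hG
  rw [show 2 * (m + 1) - 1 = m + m + 1 by omega]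
  exact fun v => hG.hasCycleIntegral_iff hQ v
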